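/- **Conventions.** Let $\Gamma$ be a countable group. A *sofic approximation* $\Sigma=\{\sigma_n\}$ to $\Gamma$ is a sequence of maps $\sigma_n:\Gamma\to\mathrm{Sym}(V_n)$ ($V_n$ a nonempty finite set) such that $|V_n|^{-1}\#\{v:\sigma_n(gh)v=\sigma_n(g)\sigma_n(h)v\}\to 1$ for all $g,h\in\Gamma$ and $|V_n|^{-1}\#\{v:\sigma_n(g)v=v\}\to 0$ for all $g\ne 1$; $\Gamma$ is *sofic* if it has one. Let $(X,d)$ be a compact metric space with an action of $\Gamma$ by homeomorphisms and an invariant Borel probability measure $\mu$. For $\delta>0$, $F\subset\Gamma$ finite and $\mathcal O\ni\mu$ a weak*-open set of Borel probability measures, let $\Omega(\sigma_n,\delta,F,\mathcal O)$ be the set of all $\phi:V_n\to X$ with $|V_n|^{-1}\sum_{v} d(\phi(\sigma_n(g)v),g\phi(v))<\delta$ for all $g\in F$ and $|V_n|^{-1}\sum_v\delta_{\phi(v)}\in\mathcal O$. Let $\mathrm{Sep}_\epsilon(S,d_\infty^{V_n})$ be the maximal cardinality of a subset of $S\subset X^{V_n}$ whose distinct elements $\phi,\psi$ satisfy $\max_v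 d(\phi(v),\psi(v))>\epsilon$. The *measure sofic entropy* is $$h_\Sigma(\Gamma\curvearrowright(X,\mu))=\sup_{\epsilon>0}\inf_{\delta>0}\inf_{F}\inf_{\mathcal O\ni\mu}\limsup_{n\to\infty}\frac1{|V_n|}\log \mathrm{Sep}_\epsilon(\Omega(\sigma_n,\delta,F,\mathcal O),d_\infty^{V_n})\in[-\infty,\infty],\qquad \log 0=-\infty .$$ Let $\mathcal A$ be a compact metric space and $\kappa$ a Borel probability measure on $\mathcal A$. Its *Shannon entropy* is $H(\kappa)=-\sum_{a}\kappa(\{a\})\log\kappa(\{a\})\in[0,\infty]$ (with $0\log0=0$) if $\kappa$ is carried by a countable set, and $H(\kappa)=+\infty$ otherwise. The *Bernoulli shift* with base $(\mathcal A,\kappa)$ is the action $(g\cdot x)(f)=x(g^{-1}f)$ of $\Gamma$ on $\mathcal A^\Gamma$ (product topology) with the product measure $\kappa^\Gamma$. Two measure-preserving actions of $\Gamma$ are *measurably conjugate* if there is an isomorphism of the measure spaces modulo null sets that is equivariant modulo null sets. **Theorem (Bernoulli shifts).** 1. Let $\Gamma$ be a countable group and $\Sigma$ a sofic approximation to $\Gamma$;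 if $\Gamma$ is finite, assume also that $|V_n|\to\infty$ (for infinite $\Gamma$ this is automatic). For every compact metric space $\mathcal A$, every Borel probability measure $\kappa$ on $\mathcal A$, and every metric on $\mathcal A^\Gamma$ inducing the product topology, $$h_\Sigma(\Gamma\curvearrowright(\mathcal A^\Gamma,\kappa^\Gamma))=H(\kappa).$$ 2. Let $\Gamma$ be a countable sofic group, and let $\kappa,\lambda$ be Borel probability measures on compact metric spaces $\mathcal A,\mathcal B$ with $H(\kappa)\neq H(\lambda)$. Then $\Gamma\curvearrowright(\mathcal A^\Gamma,\kappa^\Gamma)$ and $\Gamma\curvearrowright(\mathcal B^\Gamma,\lambda^\Gamma)$ are not measurably conjugate. 3. Let $F_2$ be the free group of rank 2. The shift actions of $F_2$ on $(\mathbb Z/2)^{F_2}$ and on $(\mathbb Z/2\times\mathbb Z/2)^{F_2}$, each with normalized Haar measure, are not measurably conjugate. -/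

import Mathlib

open MeasureTheory Filter Topology
open scoped NNReal ENNReal

noncomputable section

namespace SoficEntropy

/-! ### Sofic groups -/

/-- A sofic approximation `Σ = {σ_n : Γ → Sym(V_n)}` of `Γ`: a sequence of maps (not necessarily
homomorphisms) into the symmetric groups of nonempty finite sets, which is asymptotically
multiplicative and asymptotically free. -/
structure SoficApproximation.{u, v} (Γ : Type u) [Group Γ] : Type (max u (v + 1)) where
  V : ℕ → Type v
  [fintypeV : ∀ n, Fintype (V n)]
  [nonemptyV : ∀ n, Nonempty (V n)]
  σ : ∀ n, Γ → Equiv.Perm (V n)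
  asymptotically_multiplicative : ∀ g h : Γ,
    Tendsto (fun n ↦ (Set.ncard {v : V n | σ n (g * h) v = σ n g (σ n h v)} : ℝ)
      / Fintype.card (V n)) atTop (𝓝 1)
  asymptotically_free : ∀ g : Γ, g ≠ 1 →
    Tendsto (fun n ↦ (Set.ncard {v : V n | σ n g v = v} : ℝ) / Fintype.card (V n)) atTop (𝓝 0)

attribute [instance] SoficApproximation.fintypeV SoficApproximation.nonemptyV

/-- A group is sofic if it has a sofic approximation. -/
def IsSofic.{u} (Γ : Type u) [Group Γ] : Prop := Nonempty (SoficApproximation.{u, 0} Γ)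

/-! ### Measure sofic entropy

An action `Γ ↷ X` by homeomorphisms is a homomorphism `α : Γ →* (X ≃ₜ X)`. The metric `d` on `X`
is an explicit argument; it is meant to induce the topology of `X`. -/

section Entropy

variable {Γ X : Type*} [Group Γ] [TopologicalSpace X]

/-- The empirical distribution `|V|⁻¹ ∑_v δ_{φ(v)}` of a map `φ : V → X` on a nonempty finite
set `V`. -/
def empiricalDistribution [MeasurableSpace X] {V : Type*} [Fintype V] [Nonempty V] (φ : V → X) :
    ProbabilityMeasure X :=
  ⟨(Fintype.card V : ℝ≥0∞)⁻¹ • ∑ v, Measure.dirac (φ v), ⟨by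
    simp [ENNReal.inv_mul_cancel]⟩⟩

/-- The set `Ω(σ, δ, F)` of pseudo-periodic orbits: the maps `φ : V → X` such that
`|V|⁻¹ ∑_v d(φ(σ(g) v), g φ(v)) < δ` for all `g ∈ F`. -/
def pseudoOrbits (α : Γ →* (X ≃ₜ X)) (d : MetricSpace X) {V : Type*} [Fintype V]
    (σ : Γ → Equiv.Perm V) (δ : ℝ) (F : Finset Γ) : Set (V → X) :=
  {φ | ∀ g ∈ F, (Fintype.card V : ℝ)⁻¹ * ∑ v, d.dist (φ (σ g v)) (α g (φ v)) < δ}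

/-- `Ω(σ, δ, F, O)`: the pseudo-periodic orbits whose empirical distribution belongs to `O`. -/
def measurePseudoOrbits [MeasurableSpace X] (α : Γ →* (X ≃ₜ X)) (d : MetricSpace X) {V : Type*}
    [Fintype V] [Nonempty V] (σ : Γ → Equiv.Perm V) (δ : ℝ) (F : Finset Γ)
    (O : Set (ProbabilityMeasure X)) : Set (V → X) :=
  {φ | φ ∈ pseudoOrbits α d σ δ F ∧ empiricalDistribution φ ∈ O}

/-- `Sep_ε(S, d_∞^V)`: the maximal cardinality of an `ε`-separated subset of `S ⊆ X^V`, where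
`d_∞^V(φ, ψ) = max_v d(φ(v), ψ(v))`. -/
def sep (d : MetricSpace X) {V : Type*} [Fintype V] (ε : ℝ≥0) (S : Set (V → X)) : ℕ∞ :=
  letI := d
  Metric.packingNumber ε S

/-- The sofic entropy of `Γ ↷ (X, μ)` with respect to the sofic approximation `S`:
`sup_ε inf_δ inf_F inf_{O ∋ μ} limsup_n |V_n|⁻¹ log Sep_ε(Ω(σ_n, δ, F, O), d_∞)`. The open sets `O`
refer to the weak* topology on the space of Borel probability measures, and `log 0 = -∞`. -/
def measureSoficEntropy [MeasurableSpace X] [OpensMeasurableSpace X]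
    (S : SoficApproximation Γ) (α : Γ →* (X ≃ₜ X)) (d : MetricSpace X)
    (μ : ProbabilityMeasure X) : EReal :=
  ⨆ (ε : ℝ≥0) (_ : 0 < ε), ⨅ (δ : ℝ) (_ : 0 < δ), ⨅ (F : Finset Γ),
    ⨅ (O : Set (ProbabilityMeasure X)) (_ : IsOpen O) (_ : μ ∈ O),
      limsup (fun n ↦
        ENNReal.log (sep d ε (measurePseudoOrbits α d (S.σ n) δ F O) : ℝ≥0∞)
          / (Fintype.card (S.V n) : EReal)) atTop

end Entropy

/-! ### Measure conjugacy -/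

/-- Measure conjugacy of two actions: an isomorphism of measure spaces modulo null sets,
equivariant modulo null sets. -/
def MeasureConjugate {Γ X Y : Type*} [Group Γ] [TopologicalSpace X] [MeasurableSpace X]
    [TopologicalSpace Y] [MeasurableSpace Y] (α : Γ →* (X ≃ₜ X)) (μ : Measure X)
    (β : Γ →* (Y ≃ₜ Y)) (ν : Measure Y) : Prop :=
  ∃ (φ : X → Y) (ψ : Y → X), MeasurePreserving φ μ ν ∧ MeasurePreserving ψ ν μ ∧
    (∀ᵐ x ∂μ, ψ (φ x) = x) ∧ (∀ᵐ y ∂ν, φ (ψ y) = y) ∧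
    ∀ g : Γ, ∀ᵐ x ∂μ, φ (α g x) = β g (φ x)

/-! ### Bernoulli shifts -/

/-- The shift action `(g · x)(f) = x(g⁻¹ f)` of `Γ` on `A^Γ`. -/
def shift (Γ A : Type*) [Group Γ] [TopologicalSpace A] : Γ →* ((Γ → A) ≃ₜ (Γ → A)) where
  toFun g :=
    { toFun := fun x f ↦ x (g⁻¹ * f)
      invFun := fun x f ↦ x (g * f)
      left_inv := fun x ↦ by funext f; simp
      right_inv := fun x ↦ by funext f; simp
      continuous_toFun := by fun_prop
      continuous_invFun := by fun_prop }
  map_one' := by ext x f; simp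
  map_mul' g h := by ext x f; simp [mul_assoc]

/-- The product measure `κ^Γ` on `A^Γ`. -/
def bernoulliMeasure (Γ : Type*) {A : Type*} [MeasurableSpace A] (κ : Measure A)
    [IsProbabilityMeasure κ] : ProbabilityMeasure (Γ → A) :=
  ⟨Measure.infinitePi fun _ : Γ ↦ κ, inferInstance⟩

open Classical in
/-- The Shannon entropy `-∑_a κ({a}) log κ({a}) ∈ [0, ∞]` of a probability measure `κ` carried by a
countable set; it is `∞` if `κ` is not carried by any countable set. -/
def shannonEntropy {A : Type*} [MeasurableSpace A] (κ : Measure A) : ℝ≥0∞ :=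
  if ∃ C : Set A, C.Countable ∧ κ Cᶜ = 0 then
    ∑' a : A, ENNReal.ofReal (-(κ.real {a} * Real.log (κ.real {a})))
  else ⊤

end SoficEntropy

end

namespace SoficEntropy

/-! ### Counting words by their cost -/

/-! The entropy formula is a counting statement about colourings of `V_n`. A colouring `x : V_n → A`
gives the orbit map `pullback S x`, and at most vertices the labels `σ(g⁻¹)v`, for `g` in a fixed
finite set, are distinct. An i.i.d. colouring of law κ therefore looks locally like a sample of the
product measure, and a second-moment estimate gives a weak law of large numbers
(`improbable_average`).

Lower bound: typical colourings are approximate orbits with the right empirical distribution. A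
small sup-metric ball around a typical colouring has probability at most about `exp(-t|V_n|)` for
any `t` below the entropy, so covering a set of probability above 1/2 takes about `exp(t|V_n|)`
balls, and a maximal separated set has at least that many points (`eventually_exists_separated`).

Upper bound: an approximate orbit is nearly determined by its coordinates at the identity. These are
recorded by a word over a finite alphabet of atoms whose cost `∑ -log weight` is controlled by the
empirical distribution. Places where decoding may fail are rare and are described explicitly. A
Kraft-type inequality bounds the number of words of a given cost (`card_le_of_code`,
`measureSoficEntropy_le`).

Non-conjugacy uses the same two counts and no invariance theorem for entropy. A conjugacy and its
inverse are approximated by maps of finitely many coordinates (`exists_finite_coding`). Many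
separated κ-colourings are then encoded by cheap words over the other base, which forces `H(κ) ≤
H(l)` (`shannonEntropy_le_of_measureConjugate`); symmetry gives equality. For the free group,
soficity comes from permutations of balls in the Cayley graph, and the two base entropies are `log
2` and `log 4`. -/

theorem card_le_of_sum_neg_log_le {V L : Type*} [Fintype V] [Fintype L] (w : L → ℝ)
    (hw : ∀ l, 0 < w l) (h : ℝ) (S : Finset (V → L))
    (hS : ∀ c ∈ S, ∑ v, -Real.log (w (c v)) ≤ h) :
    (S.card : ℝ) ≤ (∑ l, w l) ^ Fintype.card V * Real.exp h := by
  classical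
  -- Expanding the power of the total weight gives a sum over all words of products of weights, and
  -- each word of `S` contributes at least `exp(-h)`.
  have key : (S.card : ℝ) * Real.exp (-h) ≤ (∑ l, w l) ^ Fintype.card V := by
    calc (S.card : ℝ) * Real.exp (-h) = ∑ c ∈ S, Real.exp (-h) := by simp
      _ ≤ ∑ c ∈ S, ∏ v, w (c v) := by
        refine Finset.sum_le_sum fun c hc ↦ ?_
        have h1 : ∏ v, w (c v) = Real.exp (∑ v, Real.log (w (c v))) := by
          rw [Real.exp_sum]
          exact Finset.prod_congr rfl fun v _ ↦ (Real.exp_log (hw _)).symm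
        rw [h1, Real.exp_le_exp]
        have := hS c hc
        rw [Finset.sum_neg_distrib] at this
        linarith
      _ ≤ ∑ c : V → L, ∏ v, w (c v) :=
        Finset.sum_le_sum_of_subset_of_nonneg (Finset.subset_univ _)
          fun c _ _ ↦ Finset.prod_nonneg fun v _ ↦ (hw _).le
      _ = (∑ l, w l) ^ Fintype.card V := by
        have := Finset.prod_univ_sum (fun _ : V ↦ (Finset.univ : Finset L)) (fun _ l ↦ w l)
        rw [Fintype.piFinset_univ] at this
        rw [← this]; simp
  rw [Real.exp_neg] at key
  rwa [← div_eq_mul_inv, div_le_iff₀ (Real.exp_pos h)] at key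

/-- Points that are determined by a word `z` of small cost, a small exceptional set `bad`, and one
out of `N` symbols at each place of the exceptional set. -/
theorem card_le_of_code {Y V Q N : Type*} [Fintype V] [Nonempty V] [Fintype Q] [Fintype N]
    [Nonempty N] (E : Finset Y) (z : Y → V → Q) (bad : Y → Finset V) (idx : Y → V → N)
    (w : Q → ℝ) (hw : ∀ q, 0 < w q) {θ : ℝ} (hθ : 0 < θ) (hW : ∑ q, w q ≤ 1 + θ) (h : ℝ)
    (inj : ∀ x ∈ E, ∀ y ∈ E, z x = z y → bad x = bad y →
      (∀ v ∈ bad x, idx x v = idx y v) → x = y)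
    (cost : ∀ x ∈ E, ∑ v, -Real.log (w (z x v)) +
      (bad x).card * Real.log (Fintype.card N / θ) ≤ Fintype.card V * h) :
    (E.card : ℝ) ≤ Real.exp (Fintype.card V * (h + 2 * θ)) := by
  classical
  have hN : (0 : ℝ) < Fintype.card N := by exact_mod_cast Fintype.card_pos
  let code : Y → V → Q × Option N := fun x v ↦
    (z x v, if v ∈ bad x then some (idx x v) else none)
  -- A place outside `bad` pays nothing extra. A total weight θ is reserved for the exceptional
  -- symbols and split evenly, so each costs `log(|N|/θ)` and the total weight is at most `(1 + θ)²
  -- ≤ exp(2θ)`.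
  let w' : Q × Option N → ℝ := fun p ↦ w p.1 * p.2.elim 1 fun _ ↦ θ / Fintype.card N
  have hw' : ∀ p, 0 < w' p := by
    rintro ⟨q, _ | n⟩
    · simpa [w'] using hw q
    · exact mul_pos (hw q) (div_pos hθ hN)
  have hsum : ∑ p, w' p = (∑ q, w q) * (1 + θ) := by
    rw [Fintype.sum_prod_type, Finset.sum_mul]
    refine Finset.sum_congr rfl fun q _ ↦ ?_
    simp only [w', ← Finset.mul_sum, Fintype.sum_option]
    simp [mul_div_cancel₀ _ hN.ne']
  have hinj : Set.InjOn code E := by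
    intro x hx y hy hxy
    have hz : z x = z y := funext fun v ↦ congrArg Prod.fst (congrFun hxy v)
    have h2 : ∀ v, (if v ∈ bad x then some (idx x v) else none) =
        (if v ∈ bad y then some (idx y v) else none) :=
      fun v ↦ congrArg Prod.snd (congrFun hxy v)
    refine inj x hx y hy hz ?_ ?_
    · ext v
      have := h2 v
      by_cases h1 : v ∈ bad x <;> by_cases h3 : v ∈ bad y <;> simp_all
    · intro v hv
      have := h2 v
      by_cases h3 : v ∈ bad y <;> simp_all
  have hcard := card_le_of_sum_neg_log_le w' hw' (Fintype.card V * h) (E.image code) (by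
    intro c hc
    obtain ⟨x, hx, rfl⟩ := Finset.mem_image.1 hc
    refine le_trans (le_of_eq ?_) (cost x hx)
    have h1 : ∀ v, -Real.log (w' (code x v)) = -Real.log (w (z x v)) +
        if v ∈ bad x then Real.log (Fintype.card N / θ) else 0 := by
      intro v
      by_cases hv : v ∈ bad x
      · simp only [w', code, hv, if_true, Option.elim]
        rw [Real.log_mul (hw _).ne' (div_pos hθ hN).ne', ← inv_div, Real.log_inv]
        ring
      · simp [w', code, hv]
    simp_rw [h1, Finset.sum_add_distrib]
    simp)
  rw [Finset.card_image_of_injOn hinj, hsum] at hcard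
  refine hcard.trans ?_
  have h0 : 0 ≤ ∑ q, w q := Finset.sum_nonneg fun q _ ↦ (hw q).le
  have h1 : (∑ q, w q) * (1 + θ) ≤ Real.exp (2 * θ) := by
    have := Real.add_one_le_exp θ
    calc (∑ q, w q) * (1 + θ) ≤ Real.exp θ * Real.exp θ := by
          gcongr <;> linarith
      _ = Real.exp (2 * θ) := by rw [← Real.exp_add]; ring_nf
  calc _ ≤ Real.exp (2 * θ) ^ Fintype.card V * Real.exp (Fintype.card V * h) := by
        gcongr
    _ = _ := by rw [← Real.exp_nat_mul, ← Real.exp_add]; ring_nf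

/-! ### Approximation by functions of finitely many coordinates -/

/-- Among finitely many points forming an ε/2-net, the index of a nearest one is a measurable
function, and two points sharing a nearest point are within ε. -/
theorem exists_measurable_quantizer (Z : Type*) [MetricSpace Z] [CompactSpace Z] [Nonempty Z]
    [MeasurableSpace Z] [OpensMeasurableSpace Z] {ε : ℝ} (hε : 0 < ε) :
    ∃ (n : ℕ) (q : Z → Fin (n + 1)), Measurable q ∧ ∀ x y, q x = q y → dist x y ≤ ε := by
  have hcov : ∃ t : Finset ℕ, (Set.univ : Set Z) ⊆
      ⋃ i ∈ t, Metric.ball (TopologicalSpace.denseSeq Z i) (ε / 2) := by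
    refine isCompact_univ.elim_finite_subcover _ (fun _ ↦ Metric.isOpen_ball) fun x _ ↦ ?_
    obtain ⟨i, hi⟩ := (TopologicalSpace.denseRange_denseSeq Z).exists_dist_lt x (half_pos hε)
    exact Set.mem_iUnion.2 ⟨i, hi⟩
  obtain ⟨t, ht⟩ := hcov
  let e := TopologicalSpace.denseSeq Z
  let N := t.sup id
  have hle := SimpleFunc.nearestPtInd_le e N
  refine ⟨N, fun x ↦ ⟨SimpleFunc.nearestPtInd e N x, Nat.lt_succ_of_le (hle x)⟩, ?_, ?_⟩
  · refine measurable_to_countable' fun k ↦ ?_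
    have := (SimpleFunc.nearestPtInd e N).measurableSet_fiber k
    convert this using 1
    ext x
    simp [Fin.ext_iff]
  · have key : ∀ x, dist (SimpleFunc.nearestPt e N x) x ≤ ε / 2 := by
      intro x
      obtain ⟨i, hi, hx⟩ := Set.mem_iUnion₂.1 (ht (Set.mem_univ x))
      have h1 := SimpleFunc.edist_nearestPt_le e x (Finset.le_sup (f := id) hi)
      rw [edist_dist, edist_dist, ENNReal.ofReal_le_ofReal_iff dist_nonneg] at h1
      rw [Metric.mem_ball, dist_comm] at hx
      exact h1.trans hx.le
    intro x y hxy
    have h2 : SimpleFunc.nearestPt e N x = SimpleFunc.nearestPt e N y := by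
      simp only [Fin.mk.injEq] at hxy
      simp [SimpleFunc.nearestPt, hxy]
    have h1 := dist_triangle_left x y (SimpleFunc.nearestPt e N x)
    have h3 := key x
    have h4 := key y
    rw [← h2] at h4
    linarith

/-- Cylinders are an algebra generating the product σ-algebra, hence dense in measure; each of the
finitely many fibres of `f` is replaced by a cylinder. This is what makes a conjugacy local. -/
theorem exists_dependsOn_approx {Γ A Q : Type*} [Countable Γ] [MeasurableSpace A] [Nonempty A]
    [Finite Q] [MeasurableSpace Q] [DiscreteMeasurableSpace Q] (μ : Measure (Γ → A))
    [IsProbabilityMeasure μ] (f : (Γ → A) → Q) (hf : Measurable f) {η : ℝ} (hη : 0 < η) :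
    ∃ (K : Finset Γ) (f' : (Γ → A) → Q), Measurable f' ∧ DependsOn f' (K : Set Γ) ∧
      μ.real {x | f x ≠ f' x} ≤ η := by
  classical
  have := Fintype.ofFinite Q
  obtain ⟨x₀⟩ := (inferInstance : Nonempty (Γ → A))
  have hd : μ.MeasureDense (measurableCylinders fun _ : Γ ↦ A) :=
    Measure.MeasureDense.of_generateFrom_isSetAlgebra_finite μ isSetAlgebra_measurableCylinders
      generateFrom_measurableCylinders.symm
  have hη' : 0 < η / (Fintype.card Q + 1) := by positivity
  have h1 : ∀ q : Q, ∃ C : Set (Γ → A), ∃ K : Finset Γ, ∃ S : Set (∀ _ : K, A),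
      MeasurableSet S ∧ C = cylinder K S ∧
      μ (symmDiff (f ⁻¹' {q}) C) < ENNReal.ofReal (η / (Fintype.card Q + 1)) := by
    intro q
    obtain ⟨C, hC, hC'⟩ := hd.approx (f ⁻¹' {q}) (hf (measurableSet_singleton q))
      (measure_ne_top _ _) _ hη'
    obtain ⟨K, S, hS, h⟩ := (mem_measurableCylinders C).1 hC
    exact ⟨C, K, S, hS, h, hC'⟩
  choose C K S hS hC hμ using h1
  have hCm : ∀ q, MeasurableSet (C q) := fun q ↦ by
    rw [hC]; exact (hS q).cylinder _
  -- the membership pattern determines the value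
  let pat : (Γ → A) → Q → Bool := fun x q ↦ decide (x ∈ C q)
  -- Off the symmetric differences exactly one cylinder contains `x`, the one indexed by `f x`; the
  -- fallback value matters only on the small exceptional set.
  let sel : (Q → Bool) → Q := fun p ↦ if h : ∃ q, p q = true ∧ ∀ q', p q' = true → q' = q
    then h.choose else f x₀
  have hpat : Measurable pat := by
    refine measurable_pi_lambda _ fun q ↦ ?_
    refine measurable_to_bool ?_
    convert hCm q using 1
    ext x; simp [pat]
  refine ⟨Finset.univ.biUnion K, sel ∘ pat, (measurable_of_finite sel).comp hpat, ?_, ?_⟩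
  · intro x y hxy
    have : pat x = pat y := by
      funext q
      simp only [pat, hC, mem_cylinder]
      have : (K q).restrict x = (K q).restrict y := by
        funext ⟨i, hi⟩
        exact hxy i (by simp only [Finset.coe_biUnion, Set.mem_iUnion]; exact ⟨q, by simp, hi⟩)
      rw [this]
    simp [this]
  · have hsub : {x | f x ≠ (sel ∘ pat) x} ⊆ ⋃ q, symmDiff (f ⁻¹' {q}) (C q) := by
      intro x hx
      by_contra hcon
      have h2 : ∀ q, x ∈ C q ↔ f x = q := by
        intro q
        have : x ∉ symmDiff (f ⁻¹' {q}) (C q) := fun h ↦ hcon (Set.mem_iUnion.2 ⟨q, h⟩)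
        rw [Set.mem_symmDiff] at this
        simp only [Set.mem_preimage, Set.mem_singleton_iff] at this
        tauto
      apply hx
      have hex : ∃ q, pat x q = true ∧ ∀ q', pat x q' = true → q' = q :=
        ⟨f x, by simp [pat, h2], fun q' h ↦ ((h2 q').1 (of_decide_eq_true h)).symm⟩
      simp only [Function.comp, sel, dif_pos hex]
      simp [pat, h2]
    have h4 : μ {x | f x ≠ (sel ∘ pat) x} ≤ ENNReal.ofReal η := by
      calc μ {x | f x ≠ (sel ∘ pat) x} ≤ ∑ q, μ (symmDiff (f ⁻¹' {q}) (C q)) :=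
            (measure_mono hsub).trans (measure_iUnion_fintype_le _ _)
        _ ≤ ∑ _q : Q, ENNReal.ofReal (η / (Fintype.card Q + 1)) :=
            Finset.sum_le_sum fun q _ ↦ (hμ q).le
        _ = ENNReal.ofReal (Fintype.card Q * (η / (Fintype.card Q + 1))) := by
            rw [Finset.sum_const, Finset.card_univ, nsmul_eq_mul,
              ENNReal.ofReal_mul (by positivity), ENNReal.ofReal_natCast]
        _ ≤ ENNReal.ofReal η := by
            refine ENNReal.ofReal_le_ofReal ?_
            rw [← mul_div_assoc, div_le_iff₀ (by positivity)]
            nlinarith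
    exact ENNReal.toReal_le_of_le_ofReal hη.le h4

/-! ### Self-information and Shannon entropy -/

/-- The self-information `-log p`, with `-log 0 = ∞`. -/
noncomputable def selfInfo (p : ℝ≥0∞) : ℝ≥0∞ := (ENNReal.log p⁻¹).toENNReal

theorem selfInfo_antitone : Antitone selfInfo := fun _ _ h ↦
  EReal.toENNReal_le_toENNReal (ENNReal.log_monotone (ENNReal.inv_le_inv.2 h))

theorem continuous_selfInfo : Continuous selfInfo := by
  unfold selfInfo
  exact EReal.continuous_toENNReal.comp (ENNReal.continuous_log.comp continuous_inv)

theorem selfInfo_zero : selfInfo 0 = ⊤ := by simp [selfInfo]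

theorem selfInfo_of_ne_zero {p : ℝ≥0∞} (h0 : p ≠ 0) (h : p ≠ ⊤) :
    selfInfo p = ENNReal.ofReal (-Real.log p.toReal) := by
  rw [selfInfo, ENNReal.log_inv, ENNReal.log_pos_real h0 h]
  rfl

theorem selfInfo_mul_self {p : ℝ≥0∞} (h : p ≠ ⊤) :
    selfInfo p * p = ENNReal.ofReal (-(p.toReal * Real.log p.toReal)) := by
  by_cases h0 : p = 0
  · simp [h0]
  · rw [selfInfo_of_ne_zero h0 h]
    conv_lhs => rw [← ENNReal.ofReal_toReal h]
    rw [ENNReal.toReal_ofReal ENNReal.toReal_nonneg, ← ENNReal.ofReal_mul' ENNReal.toReal_nonneg]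
    ring_nf

/-- Partial sums of the entropy are integrals of the self-information over finite sets. If no
countable set carries κ, the points of mass zero have positive total measure, and the
self-information is infinite there. -/
theorem shannonEntropy_le_lintegral_selfInfo {A : Type*} [MeasurableSpace A]
    [MeasurableSingletonClass A] (κ : Measure A) [IsProbabilityMeasure κ] :
    shannonEntropy κ ≤ ∫⁻ x, selfInfo (κ {x}) ∂κ := by
  unfold shannonEntropy
  split_ifs with h
  · rw [ENNReal.tsum_eq_iSup_sum]
    refine iSup_le fun T ↦ ?_
    calc _ = ∑ a ∈ T, selfInfo (κ {a}) * κ {a} :=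
          Finset.sum_congr rfl fun a _ ↦ (selfInfo_mul_self (measure_ne_top _ _)).symm
      _ = ∫⁻ x in T, selfInfo (κ {x}) ∂κ := (lintegral_finset _ _).symm
      _ ≤ _ := setLIntegral_le_lintegral _ _
  · have hc : {a : A | 0 < κ {a}}.Countable := by
      refine Measure.countable_meas_pos_of_disjoint_iUnion (μ := κ) (As := fun a : A ↦ {a})
        (fun a ↦ measurableSet_singleton a) fun a b hab ↦ ?_
      simpa using hab
    have hpos : κ {a : A | 0 < κ {a}}ᶜ ≠ 0 := fun h0 ↦ h ⟨_, hc, h0⟩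
    refine le_of_eq (Eq.symm (top_le_iff.1 ?_))
    calc (⊤ : ℝ≥0∞) = ⊤ * κ {a : A | 0 < κ {a}}ᶜ := (ENNReal.top_mul hpos).symm
      _ = ∫⁻ x in {a : A | 0 < κ {a}}ᶜ, ⊤ ∂κ := by simp
      _ = ∫⁻ x in {a : A | 0 < κ {a}}ᶜ, selfInfo (κ {x}) ∂κ := by
          refine setLIntegral_congr_fun hc.measurableSet.compl fun x hx ↦ ?_
          have : κ {x} = 0 := by simpa using hx
          rw [this, selfInfo_zero]
      _ ≤ _ := setLIntegral_le_lintegral _ _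

/-- Provides the finite alphabet of the encodings: positive letter weights, little mass outside, and
an expected cost bounded by the entropy. -/
theorem exists_finset_atoms {A : Type*} [MeasurableSpace A] [MeasurableSingletonClass A]
    (κ : Measure A) [IsProbabilityMeasure κ] (hH : shannonEntropy κ ≠ ⊤) {η : ℝ} (hη : 0 < η) :
    ∃ T : Finset A, (∀ b ∈ T, 0 < κ.real {b}) ∧ κ.real (T : Set A)ᶜ ≤ η ∧
      ∑ b ∈ T, κ.real {b} * -Real.log (κ.real {b}) ≤ (shannonEntropy κ).toReal := by
  classical
  have hsum : ∀ T : Finset A,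
      ∑ b ∈ T, κ.real {b} * -Real.log (κ.real {b}) ≤ (shannonEntropy κ).toReal := by
    intro T
    rw [← ENNReal.ofReal_le_iff_le_toReal hH, ENNReal.ofReal_sum_of_nonneg]
    · unfold shannonEntropy at hH ⊢
      split_ifs with h
      · simp only [mul_neg]
        exact ENNReal.sum_le_tsum _
      · exact le_top
    · intro b _
      have := Real.log_nonpos (measureReal_nonneg (μ := κ) (s := {b})) measureReal_le_one
      exact mul_nonneg measureReal_nonneg (by linarith)
  have hC : ∃ C : Set A, C.Countable ∧ κ Cᶜ = 0 := by
    by_contra h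
    exact hH (by rw [shannonEntropy, if_neg h])
  obtain ⟨C, hC, hC0⟩ := hC
  have hC1 : ∑' b : C, κ {(b : A)} = 1 := by
    rw [← measure_biUnion (f := fun b : A ↦ {b}) hC
      (fun a _ b _ hab ↦ by simpa [Function.onFun] using hab)
      (fun b _ ↦ measurableSet_singleton b), Set.biUnion_of_singleton]
    exact (prob_compl_eq_zero_iff hC.measurableSet).1 hC0
  obtain ⟨T₀, hT₀⟩ : ∃ T₀ : Finset C, 1 - ENNReal.ofReal η ≤ ∑ b ∈ T₀, κ {(b : A)} := by
    by_contra! hcon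
    have : (1 : ℝ≥0∞) ≤ 1 - ENNReal.ofReal η := by
      rw [← hC1, ENNReal.tsum_eq_iSup_sum]
      refine iSup_le fun T ↦ (hcon T).le.trans ?_
      rw [← ENNReal.tsum_eq_iSup_sum, hC1]
    exact absurd this (not_le.2 (ENNReal.sub_lt_self ENNReal.one_ne_top one_ne_zero (by simpa)))
  let T₁ := T₀.map (Function.Embedding.subtype _)
  let T := T₁.filter fun b ↦ 0 < κ.real {b}
  refine ⟨T, fun b hb ↦ (Finset.mem_filter.1 hb).2, ?_, hsum T⟩
  have hT : κ (T : Set A) = ∑ b ∈ T₀, κ {(b : A)} := by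
    rw [← sum_measure_singleton, show ∑ b ∈ T₀, κ {(b : A)} = ∑ b ∈ T₁, κ {b} from
      (Finset.sum_map T₀ (Function.Embedding.subtype _) fun b ↦ κ {b}).symm]
    refine Finset.sum_subset (Finset.filter_subset _ _) fun b hb hb' ↦ ?_
    by_contra h0
    exact hb' (Finset.mem_filter.2 ⟨hb, ENNReal.toReal_pos h0 (measure_ne_top _ _)⟩)
  refine ENNReal.toReal_le_of_le_ofReal hη.le ?_
  rw [prob_compl_eq_one_sub T.measurableSet, hT]
  exact tsub_le_iff_tsub_le.1 hT₀

theorem measurable_measure_closedBall {A : Type*} [MetricSpace A] [SecondCountableTopology A]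
    [MeasurableSpace A] [BorelSpace A] (κ : Measure A) [SFinite κ] (r : ℝ) :
    Measurable fun x ↦ κ (Metric.closedBall x r) := by
  have h : MeasurableSet {p : A × A | dist p.2 p.1 ≤ r} :=
    (isClosed_le (by fun_prop) continuous_const).measurableSet
  exact measurable_measure_prodMk_left h

/-- The self-information of the closed ball of radius `1/(n+1)`, truncated at `n`, increases with
`n` to at least that of the point, so its integral eventually exceeds `t` by monotone convergence.
Truncation gives the boundedness required by the law of large numbers. -/
theorem exists_bounded_information {A : Type*} [MetricSpace A] [SecondCountableTopology A]
    [MeasurableSpace A] [BorelSpace A] (κ : Measure A) [IsProbabilityMeasure κ] {t : ℝ}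
    (ht : (t : EReal) < shannonEntropy κ) :
    ∃ ε : ℝ, 0 < ε ∧ ∃ (g : A → ℝ) (M : ℝ), Measurable g ∧ (∀ x, |g x| ≤ M) ∧ t < ∫ x, g x ∂κ ∧
      ∀ x, κ (Metric.closedBall x ε) ≤ ENNReal.ofReal (Real.exp (-g x)) := by
  rcases lt_or_ge t 0 with h0 | h0
  · exact ⟨1, one_pos, fun _ ↦ 0, 0, measurable_const, by simp, by simpa, fun x ↦ by
      simpa using prob_le_one⟩
  have ht' : ENNReal.ofReal t < ∫⁻ x, selfInfo (κ {x}) ∂κ := by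
    refine lt_of_lt_of_le ?_ (shannonEntropy_le_lintegral_selfInfo κ)
    rw [← EReal.coe_ennreal_lt_coe_ennreal_iff]
    simpa [h0] using ht
  let r : ℕ → ℝ := fun n ↦ 1 / ((n : ℝ) + 1)
  have hr : Antitone r := fun m n hmn ↦ by
    simp only [r]; gcongr
  have hr0 : Tendsto r atTop (𝓝 0) := tendsto_one_div_add_atTop_nhds_zero_nat
  let u : ℕ → A → ℝ≥0∞ := fun n x ↦ min (n : ℝ≥0∞) (selfInfo (κ (Metric.closedBall x (r n))))
  have hu : ∀ n, Measurable (u n) := fun n ↦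
    measurable_const.min (continuous_selfInfo.measurable.comp (measurable_measure_closedBall κ _))
  have hmono : Monotone u := fun m n hmn x ↦ min_le_min (by exact_mod_cast hmn)
    (selfInfo_antitone (measure_mono (Metric.closedBall_subset_closedBall (hr hmn))))
  have hlim : ∀ x, selfInfo (κ {x}) ≤ ⨆ n, u n x := by
    intro x
    have h1 : Tendsto (fun n ↦ κ (Metric.closedBall x (r n))) atTop (𝓝 (κ {x})) := by
      have h2 : ⋂ n, Metric.closedBall x (r n) = {x} := by
        ext y
        simp only [Set.mem_iInter, Metric.mem_closedBall, Set.mem_singleton_iff]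
        refine ⟨fun h ↦ dist_le_zero.1 (ge_of_tendsto' hr0 h), ?_⟩
        rintro rfl n
        simp only [dist_self, r]; positivity
      rw [← h2]
      exact tendsto_measure_iInter_atTop
        (fun n ↦ Metric.isClosed_closedBall.measurableSet.nullMeasurableSet)
        (fun m n hmn ↦ Metric.closedBall_subset_closedBall (hr hmn)) ⟨0, measure_ne_top _ _⟩
    have h3 : Tendsto (fun n ↦ u n x) atTop (𝓝 (min ⊤ (selfInfo (κ {x})))) :=
      ENNReal.tendsto_nat_nhds_top.min ((continuous_selfInfo.tendsto _).comp h1)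
    rw [min_eq_right le_top] at h3
    exact le_of_tendsto' h3 fun n ↦ le_iSup (fun n ↦ u n x) n
  have h4 : ENNReal.ofReal t < ⨆ n, ∫⁻ x, u n x ∂κ := by
    rw [← lintegral_iSup hu hmono]
    exact ht'.trans_le (lintegral_mono hlim)
  obtain ⟨n, hn⟩ := lt_iSup_iff.1 h4
  have hfin : ∀ x, u n x ≤ n := fun x ↦ min_le_left _ _
  have hfin' : ∀ x, u n x ≠ ⊤ := fun x ↦ ne_top_of_le_ne_top (ENNReal.natCast_ne_top n) (hfin x)
  refine ⟨r n, by simp only [r]; positivity, fun x ↦ (u n x).toReal, n, (hu n).ennreal_toReal,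
    fun x ↦ ?_, ?_, fun x ↦ ?_⟩
  · rw [abs_of_nonneg ENNReal.toReal_nonneg]
    exact ENNReal.toReal_le_of_le_ofReal (by positivity) (by simpa using hfin x)
  · rw [integral_toReal (hu n).aemeasurable (ae_of_all _ fun x ↦ (hfin' x).lt_top),
      ← ENNReal.ofReal_lt_iff_lt_toReal h0]
    · exact hn
    · refine ne_top_of_le_ne_top (ENNReal.natCast_ne_top n) ?_
      calc ∫⁻ x, u n x ∂κ ≤ ∫⁻ _, n ∂κ := lintegral_mono hfin
        _ = n := by simp
  · set p := κ (Metric.closedBall x (r n)) with hp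
    by_cases hp0 : p = 0
    · simp [hp0]
    have hpt : p ≠ ⊤ := measure_ne_top _ _
    have h5 : u n x ≤ ENNReal.ofReal (-Real.log p.toReal) := by
      rw [← selfInfo_of_ne_zero hp0 hpt]; exact min_le_right _ _
    have hp1 : p.toReal ≤ 1 := ENNReal.toReal_le_of_le_ofReal zero_le_one (by
      simpa using prob_le_one)
    have h6 : (u n x).toReal ≤ -Real.log p.toReal := ENNReal.toReal_le_of_le_ofReal
      (by have := Real.log_nonpos ENNReal.toReal_nonneg hp1; linarith) h5
    rw [← ENNReal.ofReal_toReal hpt]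
    refine ENNReal.ofReal_le_ofReal ?_
    rw [← Real.log_le_iff_le_exp (ENNReal.toReal_pos hp0 hpt)]
    linarith

/-! ### Negligible sets of points of a sofic approximation -/

section Negligible

variable {Γ : Type*} [Group Γ] (S : SoficApproximation Γ)

/-- The points of `V_n` satisfying `p` have asymptotic density zero. -/
def Negligible (p : ∀ n, S.V n → Prop) : Prop :=
  Tendsto (fun n ↦ (Set.ncard {v | p n v} : ℝ) / Fintype.card (S.V n)) atTop (𝓝 0)

variable {S}

theorem card_V_pos (n : ℕ) : (0 : ℝ) < Fintype.card (S.V n) := by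
  exact_mod_cast Fintype.card_pos

theorem Negligible.mono {p q : ∀ n, S.V n → Prop} (hq : Negligible S q)
    (h : ∀ n v, p n v → q n v) : Negligible S p := by
  refine squeeze_zero (fun n ↦ by positivity) (fun n ↦ ?_) hq
  have : (Set.ncard {v | p n v} : ℝ) ≤ Set.ncard {v | q n v} := by
    exact_mod_cast Set.ncard_le_ncard (h n) (Set.toFinite _)
  gcongr

theorem Negligible.or {p q : ∀ n, S.V n → Prop} (hp : Negligible S p) (hq : Negligible S q) :
    Negligible S fun n v ↦ p n v ∨ q n v := by
  refine squeeze_zero (fun n ↦ by positivity) (fun n ↦ ?_) (by simpa using hp.add hq)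
  have : (Set.ncard {v | p n v ∨ q n v} : ℝ) ≤ Set.ncard {v | p n v} + Set.ncard {v | q n v} := by
    exact_mod_cast Set.ncard_union_le _ _
  rw [← add_div]
  gcongr

theorem Negligible.false : Negligible S fun _ _ ↦ False := by
  simp [Negligible]

theorem Negligible.exists_finset {ι : Type*} (K : Finset ι) {p : ι → ∀ n, S.V n → Prop}
    (hp : ∀ i ∈ K, Negligible S (p i)) : Negligible S fun n v ↦ ∃ i ∈ K, p i n v := by
  classical
  induction K using Finset.induction_on with
  | empty => simpa using Negligible.false
  | insert i K _ ih =>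
    have h1 := (hp i (Finset.mem_insert_self _ _)).or
      (ih fun j hj ↦ hp j (Finset.mem_insert_of_mem hj))
    exact h1.mono fun n v h ↦ by simpa using h

theorem Negligible.comp_perm {p : ∀ n, S.V n → Prop} (hp : Negligible S p)
    (π : ∀ n, Equiv.Perm (S.V n)) : Negligible S fun n v ↦ p n (π n v) := by
  have : ∀ n, Set.ncard {v | p n (π n v)} = Set.ncard {v | p n v} := fun n ↦ by
    rw [← Set.ncard_image_of_injective _ (π n).injective]
    congr 1
    ext v
    simp only [Set.mem_image, Set.mem_ofPred_eq]
    exact ⟨by rintro ⟨w, hw, rfl⟩; exact hw, fun h ↦ ⟨(π n).symm v, by simpa, by simp⟩⟩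
  simpa [Negligible, this] using hp

theorem negligible_not_mul (g h : Γ) :
    Negligible S fun n v ↦ S.σ n (g * h) v ≠ S.σ n g (S.σ n h v) := by
  have h1 := (tendsto_const_nhds (x := (1 : ℝ))).sub (S.asymptotically_multiplicative g h)
  rw [sub_self] at h1
  refine h1.congr fun n ↦ ?_
  have h2 := Set.ncard_add_ncard_compl {v : S.V n | S.σ n (g * h) v = S.σ n g (S.σ n h v)}
  rw [Nat.card_eq_fintype_card] at h2
  have h3 : (Set.ncard {v : S.V n | S.σ n (g * h) v = S.σ n g (S.σ n h v)} : ℝ) +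
      Set.ncard {v : S.V n | S.σ n (g * h) v ≠ S.σ n g (S.σ n h v)} = Fintype.card (S.V n) := by
    exact_mod_cast h2
  have := card_V_pos (S := S) n
  rw [eq_div_iff this.ne', sub_mul, one_mul, div_mul_cancel₀ _ this.ne']
  linarith

/-- Where multiplicativity holds for the pair `(g * h⁻¹, h)`, equality of the two images makes
`σ(h)v` a fixed point of `σ(g * h⁻¹)`. -/
theorem negligible_eq {g h : Γ} (hgh : g ≠ h) :
    Negligible S fun n v ↦ S.σ n g v = S.σ n h v := by
  have h1 : Negligible S fun n v ↦ S.σ n (g * h⁻¹) v = v :=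
    S.asymptotically_free _ fun h0 ↦ hgh (by simpa [mul_inv_eq_one] using h0)
  refine ((h1.comp_perm fun n ↦ S.σ n h).or (negligible_not_mul (g * h⁻¹) h)).mono fun n v hv ↦ ?_
  rw [inv_mul_cancel_right]
  by_cases h3 : S.σ n g v = S.σ n (g * h⁻¹) (S.σ n h v)
  · exact Or.inl (by rw [← h3, hv])
  · exact Or.inr h3

/-- At the remaining vertices the colours seen through `K` are distinct coordinates of the
colouring. The inverses match those in `pullback`. -/
theorem negligible_not_injOn (K : Finset Γ) :
    Negligible S fun n v ↦ ¬ Set.InjOn (fun g ↦ S.σ n g⁻¹ v) (K : Set Γ) := by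
  classical
  refine (Negligible.exists_finset (K.product K |>.filter fun p ↦ p.1 ≠ p.2)
    (p := fun p n v ↦ S.σ n p.1⁻¹ v = S.σ n p.2⁻¹ v) fun p hp ↦ negligible_eq ?_).mono ?_
  · simpa using (Finset.mem_filter.1 hp).2
  · intro n v h
    simp only [Set.InjOn, not_forall] at h
    obtain ⟨g, hg, g', hg', h, hne⟩ := h
    exact ⟨(g, g'), Finset.mem_filter.2 ⟨Finset.mem_product.2 ⟨hg, hg'⟩, hne⟩, h⟩

/-- A single vertex at which `N` group elements act differently already shows `|V_n| ≥ N`. -/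
theorem tendsto_card_V [Infinite Γ] : Tendsto (fun n ↦ Fintype.card (S.V n)) atTop atTop := by
  refine tendsto_atTop.2 fun N ↦ ?_
  obtain ⟨K, hK⟩ := Infinite.exists_subset_card_eq Γ N
  have h := negligible_not_injOn (S := S) K
  filter_upwards [h.eventually (gt_mem_nhds one_pos)] with n hn
  rw [div_lt_one (card_V_pos n)] at hn
  by_contra! hcon
  have : {v | ¬ Set.InjOn (fun g ↦ S.σ n g⁻¹ v) (K : Set Γ)} = Set.univ := by
    refine Set.eq_univ_of_forall fun v hv ↦ ?_
    have := Finset.card_le_card_of_injOn (t := Finset.univ) _ (fun _ _ ↦ Finset.mem_univ _) hv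
    rw [hK, Finset.card_univ] at this
    omega
  rw [this, Set.ncard_univ, Nat.card_eq_fintype_card] at hn
  exact lt_irrefl _ hn

end Negligible

/-! ### The weak law of large numbers along a sofic approximation -/

section SecondMoment

variable {Γ A V : Type*} [MeasurableSpace A] [Nonempty A] (κ : Measure A)
  [IsProbabilityMeasure κ] {F : (Γ → A) → ℝ} (hF : Measurable F) {K : Finset Γ}
  (hK : DependsOn F (K : Set Γ)) (τ : Γ → V → V)

include hF hK

/-- Restricting an i.i.d. family along an injection gives an i.i.d. family, so both integrals equal
one over `K → A`; the coordinates outside `K` are filled with an arbitrary point. -/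
theorem integral_comp_of_injOn {v : V} (hv : Set.InjOn (fun g ↦ τ g v) (K : Set Γ)) :
    ∫ x, F (fun g ↦ x (τ g v)) ∂(Measure.infinitePi fun _ : V ↦ κ) =
      ∫ x, F x ∂(Measure.infinitePi fun _ : Γ ↦ κ) := by
  classical
  obtain ⟨a₀⟩ := (inferInstance : Nonempty A)
  let ext : (K → A) → Γ → A := fun y g ↦ if h : g ∈ K then y ⟨g, h⟩ else a₀
  have hext : Measurable ext := measurable_pi_lambda _ fun g ↦ by
    by_cases h : g ∈ K
    · simpa [ext, h] using measurable_pi_apply _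
    · simp [ext, h]
  have h1 : ∀ x : Γ → A, F x = F (ext fun k ↦ x k) := fun x ↦ hK fun g hg ↦ by
    simp [ext, Finset.mem_coe.1 hg]
  have h2 := Measure.map_infinitePi_infinitePi_of_inj (P := fun _ : Γ ↦ κ)
    (f := fun k : K ↦ (k : Γ)) Subtype.val_injective
  have h3 := Measure.map_infinitePi_infinitePi_of_inj (P := fun _ : V ↦ κ)
    (f := fun k : K ↦ τ k v) fun k l h ↦ Subtype.ext (hv k.2 l.2 h)
  have hm : AEStronglyMeasurable (fun y ↦ F (ext y)) (Measure.infinitePi fun _ : K ↦ κ) :=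
    (hF.comp hext).aestronglyMeasurable
  calc _ = ∫ x, F (ext fun k ↦ x (τ k v)) ∂(Measure.infinitePi fun _ : V ↦ κ) :=
        integral_congr_ae (ae_of_all _ fun x ↦ h1 _)
    _ = ∫ y, F (ext y) ∂(Measure.infinitePi fun _ : K ↦ κ) := by
        rw [← h3, integral_map (measurable_pi_lambda _ fun k ↦ measurable_pi_apply _).aemeasurable (by rw [h3]; exact hm)]
    _ = ∫ x, F (ext fun k ↦ x k) ∂(Measure.infinitePi fun _ : Γ ↦ κ) := by
        rw [← h2, integral_map (measurable_pi_lambda _ fun k ↦ measurable_pi_apply _).aemeasurable (by rw [h2]; exact hm)]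
    _ = _ := integral_congr_ae (ae_of_all _ fun x ↦ (h1 x).symm)

theorem indepFun_of_disjoint {v w : V} (h : ∀ g ∈ K, ∀ g' ∈ K, τ g v ≠ τ g' w) :
    ProbabilityTheory.IndepFun (fun x : V → A ↦ F fun g ↦ x (τ g v))
      (fun x ↦ F fun g ↦ x (τ g w)) (Measure.infinitePi fun _ : V ↦ κ) := by
  classical
  obtain ⟨a₀⟩ := (inferInstance : Nonempty A)
  let T : V → Finset V := fun v ↦ K.image fun g ↦ τ g v
  let ext : ∀ v, (T v → A) → Γ → A := fun v y g ↦ if h : τ g v ∈ T v then y ⟨τ g v, h⟩ else a₀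
  have hext : ∀ v, Measurable (ext v) := fun v ↦ measurable_pi_lambda _ fun g ↦ by
    by_cases h : τ g v ∈ T v
    · simpa [ext, h] using measurable_pi_apply _
    · simp [ext, h]
  have h1 : ∀ v (x : V → A), F (fun g ↦ x (τ g v)) = F (ext v fun u ↦ x u) :=
    fun v x ↦ hK fun g hg ↦ by
      have : τ g v ∈ T v := Finset.mem_image_of_mem _ hg
      simp [ext, this]
  have hd : Disjoint (T v) (T w) := by
    rw [Finset.disjoint_left]
    intro u hu hu'
    obtain ⟨g, hg, rfl⟩ := Finset.mem_image.1 hu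
    obtain ⟨g', hg', hgg⟩ := Finset.mem_image.1 hu'
    exact h g hg g' hg' hgg.symm
  have hind := (ProbabilityTheory.iIndepFun_infinitePi (P := fun _ : V ↦ κ)
    (X := fun _ a ↦ a) fun _ ↦ measurable_id).indepFun_finset (T v) (T w) hd
      (fun u ↦ measurable_pi_apply u)
  have := hind.comp (hF.comp (hext v)) (hF.comp (hext w))
  simp only [h1]
  exact this

/-- The covariance of the terms at `v` and `w` vanishes unless `K` fails to act injectively at `v`
or the `K`-neighbourhoods of `v` and `w` meet. The remaining pairs are counted and bounded
trivially. -/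
theorem integral_sq_sum_le [Fintype V] (hτ : ∀ g, Function.Injective (τ g)) {M : ℝ}
    (hM : ∀ x, |F x| ≤ M) :
    ∫ x, (∑ v, (F (fun g ↦ x (τ g v)) - ∫ y, F y ∂(Measure.infinitePi fun _ : Γ ↦ κ))) ^ 2
      ∂(Measure.infinitePi fun _ : V ↦ κ) ≤
    (2 * M) ^ 2 * ((Set.ncard {v | ¬ Set.InjOn (fun g ↦ τ g v) (K : Set Γ)} +
      (K.card : ℝ) ^ 2) * Fintype.card V) := by
  classical
  set P := Measure.infinitePi fun _ : V ↦ κ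
  set m := ∫ y, F y ∂(Measure.infinitePi fun _ : Γ ↦ κ) with hm
  let X : V → (V → A) → ℝ := fun v x ↦ F (fun g ↦ x (τ g v)) - m
  have hmM : |m| ≤ M := by
    have := norm_integral_le_of_norm_le_const (μ := Measure.infinitePi fun _ : Γ ↦ κ)
      (ae_of_all _ fun x ↦ (Real.norm_eq_abs (F x)).le.trans (hM x))
    simpa using this
  have hX : ∀ v, Measurable (X v) := fun v ↦
    (hF.comp (measurable_pi_lambda _ fun g ↦ measurable_pi_apply _)).sub_const _
  have hXM : ∀ v x, |X v x| ≤ 2 * M := fun v x ↦ by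
    have := abs_sub (F (fun g ↦ x (τ g v))) m
    have := hM (fun g ↦ x (τ g v))
    simp only [X]
    linarith
  have hM0 : 0 ≤ M := (abs_nonneg m).trans hmM
  have hint : ∀ v w, Integrable (fun x ↦ X v x * X w x) P := fun v w ↦ by
    refine Integrable.of_bound ((hX v).mul (hX w)).aestronglyMeasurable ((2 * M) * (2 * M))
      (ae_of_all _ fun x ↦ ?_)
    rw [Real.norm_eq_abs, abs_mul]
    exact mul_le_mul (hXM v x) (hXM w x) (abs_nonneg _) (by linarith)
  let B : Finset V := Finset.univ.filter fun v ↦ ¬ Set.InjOn (fun g ↦ τ g v) (K : Set Γ)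
  -- By injectivity of `τ g'`, each pair `(g, g')` allows at most one `w`; hence the bound `|K|²`.
  let N : V → Finset V := fun v ↦ Finset.univ.filter fun w ↦ ∃ g ∈ K, ∃ g' ∈ K, τ g v = τ g' w
  have hN : ∀ v, ((N v).card : ℝ) ≤ (K.card : ℝ) ^ 2 := by
    intro v
    have h1 : N v ⊆ (K ×ˢ K).biUnion fun p ↦ Finset.univ.filter fun w ↦ τ p.1 v = τ p.2 w := by
      intro w hw
      obtain ⟨g, hg, g', hg', h⟩ := (Finset.mem_filter.1 hw).2
      exact Finset.mem_biUnion.2 ⟨(g, g'), Finset.mem_product.2 ⟨hg, hg'⟩, by simpa using h⟩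
    have h2 : (N v).card ≤ (K ×ˢ K).card * 1 := (Finset.card_le_card h1).trans
      (Finset.card_biUnion_le_card_mul _ _ _ fun p _ ↦ Finset.card_le_one.2 fun w hw w' hw' ↦
        hτ p.2 (((Finset.mem_filter.1 hw).2).symm.trans (Finset.mem_filter.1 hw').2))
    rw [Finset.card_product, mul_one] at h2
    rw [sq]
    exact_mod_cast h2
  have hcov : ∀ v w, ∫ x, X v x * X w x ∂P ≤
      (2 * M) ^ 2 * ((if v ∈ B then 1 else 0) + if w ∈ N v then 1 else 0) := by
    intro v w
    -- Only `v` has to be good: after independence factors the integral, one vanishing mean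
    -- suffices.
    by_cases hc : v ∉ B ∧ w ∉ N v
    · have hv : Set.InjOn (fun g ↦ τ g v) (K : Set Γ) := by
        by_contra h; exact hc.1 (Finset.mem_filter.2 ⟨Finset.mem_univ _, h⟩)
      have hvw : ∀ g ∈ K, ∀ g' ∈ K, τ g v ≠ τ g' w := fun g hg g' hg' h ↦
        hc.2 (Finset.mem_filter.2 ⟨Finset.mem_univ _, g, hg, g', hg', h⟩)
      have h1 : ∫ x, X v x ∂P = 0 := by
        have h2 : Integrable (fun x : V → A ↦ F fun g ↦ x (τ g v)) P :=
          Integrable.of_bound (hF.comp (measurable_pi_lambda _ fun g ↦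
            measurable_pi_apply _)).aestronglyMeasurable M (ae_of_all _ fun x ↦ hM _)
        simp only [X]
        rw [integral_sub h2 (integrable_const _), integral_comp_of_injOn κ hF hK τ hv]
        simp [hm]
      have h3 := (indepFun_of_disjoint κ hF hK τ hvw).comp
        (φ := fun y ↦ y - m) (ψ := fun y ↦ y - m) (by fun_prop) (by fun_prop)
      have h4 := h3.integral_fun_mul_eq_mul_integral (hX v).aestronglyMeasurable
        (hX w).aestronglyMeasurable
      have h5 : ∫ x, X v x * X w x ∂P = (∫ x, X v x ∂P) * ∫ x, X w x ∂P := h4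
      rw [h5, h1]
      simp [hc.1, hc.2]
    · have h1 : ∫ x, X v x * X w x ∂P ≤ (2 * M) ^ 2 := by
        calc _ ≤ ∫ _, (2 * M) ^ 2 ∂P := by
              refine integral_mono (hint v w) (integrable_const _) fun x ↦ ?_
              refine (le_abs_self _).trans ?_
              rw [abs_mul, sq]
              exact mul_le_mul (hXM v x) (hXM w x) (abs_nonneg _) (by linarith)
          _ = _ := by simp
      have h2 : (1 : ℝ) ≤ (if v ∈ B then 1 else 0) + if w ∈ N v then 1 else 0 := by
        by_cases h3 : v ∈ B <;> by_cases h4 : w ∈ N v <;> simp_all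
      nlinarith [sq_nonneg (2 * M)]
  calc _ = ∑ v, ∑ w, ∫ x, X v x * X w x ∂P := by
        simp_rw [sq, Finset.sum_mul_sum]
        rw [integral_finsetSum _ fun v _ ↦ integrable_finsetSum _ fun w _ ↦ hint v w]
        exact Finset.sum_congr rfl fun v _ ↦ integral_finsetSum _ fun w _ ↦ hint v w
    _ ≤ ∑ v, ∑ w, (2 * M) ^ 2 * ((if v ∈ B then 1 else 0) + if w ∈ N v then 1 else 0) :=
        Finset.sum_le_sum fun v _ ↦ Finset.sum_le_sum fun w _ ↦ hcov v w
    _ = (2 * M) ^ 2 * (B.card * Fintype.card V + ∑ v, ((N v).card : ℝ)) := by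
        simp_rw [← Finset.mul_sum, Finset.sum_add_distrib]
        simp [mul_comm]
    _ ≤ (2 * M) ^ 2 * (B.card * Fintype.card V + ∑ _v : V, (K.card : ℝ) ^ 2) := by
        gcongr with v; exact hN v
    _ = _ := by
        have : (Set.ncard {v | ¬ Set.InjOn (fun g ↦ τ g v) (K : Set Γ)} : ℝ) = B.card := by
          rw [← Set.ncard_coe_finset]; simp [B]
        rw [this]; simp; ring_nf; tauto

end SecondMoment

section LawOfLargeNumbers

variable {Γ A : Type*} [Group Γ] (S : SoficApproximation Γ)

/-- The orbit map `v ↦ (g ↦ x(σ(g⁻¹) v))` of a colouring `x` of `V_n`. -/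
def pullback {n : ℕ} (x : S.V n → A) (v : S.V n) : Γ → A := fun g ↦ x (S.σ n g⁻¹ v)

variable [MeasurableSpace A] (κ : Measure A)

/-- The law of a random colouring of `V_n` with independent colours. -/
noncomputable def colouring (n : ℕ) : Measure (S.V n → A) := Measure.infinitePi fun _ ↦ κ

instance [IsProbabilityMeasure κ] (n : ℕ) : IsProbabilityMeasure (colouring S κ n) := by
  unfold colouring; infer_instance

/-- The colourings satisfying `p` have probability tending to zero. -/
def Improbable (p : ∀ n, (S.V n → A) → Prop) : Prop :=
  Tendsto (fun n ↦ (colouring S κ n).real {x | p n x}) atTop (𝓝 0)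

variable {S κ}

theorem Improbable.mono_eventually [IsProbabilityMeasure κ] {p q : ∀ n, (S.V n → A) → Prop}
    (hq : Improbable S κ q) (h : ∀ᶠ n in atTop, ∀ x, p n x → q n x) : Improbable S κ p := by
  refine squeeze_zero' (Eventually.of_forall fun n ↦ measureReal_nonneg) ?_ hq
  filter_upwards [h] with n hn
  exact measureReal_mono hn

theorem Improbable.mono [IsProbabilityMeasure κ] {p q : ∀ n, (S.V n → A) → Prop}
    (hq : Improbable S κ q) (h : ∀ n x, p n x → q n x) : Improbable S κ p :=
  hq.mono_eventually (Eventually.of_forall h)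

theorem Improbable.or [IsProbabilityMeasure κ] {p q : ∀ n, (S.V n → A) → Prop}
    (hp : Improbable S κ p) (hq : Improbable S κ q) : Improbable S κ fun n x ↦ p n x ∨ q n x :=
  squeeze_zero (fun n ↦ measureReal_nonneg)
    (fun n ↦ measureReal_union_le {x | p n x} {x | q n x}) (by simpa using Tendsto.add hp hq)

variable [Nonempty A] [IsProbabilityMeasure κ]

/-- Chebyshev's inequality applied to `integral_sq_sum_le`: the bound is a constant times the
density of bad vertices plus `|K|²/|V_n|`, and the second term is where growth of `V_n` is needed.
-/
theorem improbable_average (hV : Tendsto (fun n ↦ Fintype.card (S.V n)) atTop atTop)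
    {F : (Γ → A) → ℝ} (hF : Measurable F) {K : Finset Γ} (hK : DependsOn F (K : Set Γ)) {M : ℝ}
    (hM : ∀ x, |F x| ≤ M) {η : ℝ} (hη : 0 < η) :
    Improbable S κ fun n x ↦ η ≤ |(Fintype.card (S.V n) : ℝ)⁻¹ * ∑ v, F (pullback S x v) -
      ∫ y, F y ∂(Measure.infinitePi fun _ : Γ ↦ κ)| := by
  set m := ∫ y, F y ∂(Measure.infinitePi fun _ : Γ ↦ κ) with hm
  have hV' : Tendsto (fun n ↦ (K.card : ℝ) ^ 2 / (Fintype.card (S.V n) : ℝ)) atTop (𝓝 0) :=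
    tendsto_const_nhds.div_atTop (tendsto_natCast_atTop_atTop.comp hV)
  have hlim : Tendsto (fun n ↦ (2 * M) ^ 2 / η ^ 2 *
      ((Set.ncard {v | ¬ Set.InjOn (fun g ↦ S.σ n g⁻¹ v) (K : Set Γ)} : ℝ) /
        Fintype.card (S.V n) + (K.card : ℝ) ^ 2 / (Fintype.card (S.V n) : ℝ))) atTop (𝓝 0) := by
    simpa using ((negligible_not_injOn (S := S) K).add hV').const_mul ((2 * M) ^ 2 / η ^ 2)
  refine squeeze_zero (fun n ↦ measureReal_nonneg) (fun n ↦ ?_) hlim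
  have hc := card_V_pos (S := S) n
  have h1 := integral_sq_sum_le κ hF hK (fun g v ↦ S.σ n g⁻¹ v)
    (fun g ↦ (S.σ n g⁻¹).injective) hM
  rw [← hm] at h1
  set c : ℝ := (Fintype.card (S.V n) : ℝ)
  have hX : Measurable fun x : S.V n → A ↦ ∑ v, (F (fun g ↦ x (S.σ n g⁻¹ v)) - m) :=
    Finset.measurable_sum _ fun v _ ↦
      (hF.comp (measurable_pi_lambda _ fun g ↦ measurable_pi_apply _)).sub_const _
  have hmM : |m| ≤ M := by
    have := norm_integral_le_of_norm_le_const (μ := Measure.infinitePi fun _ : Γ ↦ κ)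
      (ae_of_all _ fun x ↦ (Real.norm_eq_abs (F x)).le.trans (hM x))
    simpa using this
  have hb : ∀ x : S.V n → A, |∑ v, (F (fun g ↦ x (S.σ n g⁻¹ v)) - m)| ≤ c * (2 * M) := by
    intro x
    refine (Finset.abs_sum_le_sum_abs _ _).trans ?_
    calc _ ≤ ∑ _v : S.V n, 2 * M := Finset.sum_le_sum fun v _ ↦ by
          have := abs_sub (F (fun g ↦ x (S.σ n g⁻¹ v))) m
          have := hM (fun g ↦ x (S.σ n g⁻¹ v))
          linarith
      _ = _ := by simp [c]
  have h2 := mul_meas_ge_le_integral_of_nonneg (μ := colouring S κ n)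
    (f := fun x ↦ (∑ v, (F (fun g ↦ x (S.σ n g⁻¹ v)) - m)) ^ 2)
    (ae_of_all _ fun x ↦ sq_nonneg _)
    (Integrable.of_bound (hX.pow_const 2).aestronglyMeasurable ((c * (2 * M)) ^ 2)
      (ae_of_all _ fun x ↦ by
        rw [Real.norm_eq_abs, abs_pow]
        exact pow_le_pow_left₀ (abs_nonneg _) (hb x) 2)) ((η * c) ^ 2)
  have h3 : {x : S.V n → A | η ≤ |c⁻¹ * ∑ v, F (pullback S x v) - m|} ⊆
      {x | (η * c) ^ 2 ≤ (∑ v, (F (fun g ↦ x (S.σ n g⁻¹ v)) - m)) ^ 2} := by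
    intro x hx
    have h4 : ∑ v, (F (fun g ↦ x (S.σ n g⁻¹ v)) - m) =
        c * (c⁻¹ * ∑ v, F (pullback S x v) - m) := by
      rw [Finset.sum_sub_distrib, mul_sub, mul_inv_cancel_left₀ hc.ne']
      simp only [Finset.sum_const, Finset.card_univ, nsmul_eq_mul, c]
      rfl
    rw [Set.mem_ofPred_eq] at hx ⊢
    rw [h4, ← sq_abs (c * _), abs_mul, abs_of_pos hc, mul_comm c]
    gcongr
  have h5 := h2.trans h1
  rw [mul_comm, ← le_div_iff₀ (by positivity)] at h5
  refine (measureReal_mono h3).trans (h5.trans (le_of_eq ?_))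
  field_simp

end LawOfLargeNumbers

/-! ### Large separated sets of colourings -/

theorem exists_maximal_separated {Y : Type*} (p : Y → Prop) (r : Y → Y → Prop) {N : ℝ}
    (hN : ∀ C : Finset Y, (∀ x ∈ C, p x) → (∀ x ∈ C, ∀ y ∈ C, x ≠ y → r x y) → (C.card : ℝ) ≤ N)
    (hr : ∀ x y, r x y → r y x) (hirr : ∀ x, ¬ r x x) :
    ∃ C : Finset Y, (∀ x ∈ C, p x) ∧ (∀ x ∈ C, ∀ y ∈ C, x ≠ y → r x y) ∧
      ∀ x, p x → ∃ c ∈ C, ¬ r x c := by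
  classical
  let T : Set ℕ := {k | ∃ C : Finset Y, (∀ x ∈ C, p x) ∧
    (∀ x ∈ C, ∀ y ∈ C, x ≠ y → r x y) ∧ C.card = k}
  have hT : T.Nonempty := ⟨0, ∅, by simp, by simp, rfl⟩
  have hb : BddAbove T := ⟨⌊N⌋₊, by
    rintro k ⟨C, h1, h2, rfl⟩
    exact Nat.le_floor (hN C h1 h2)⟩
  obtain ⟨C, h1, h2, h3⟩ := Nat.sSup_mem hT hb
  refine ⟨C, h1, h2, fun x hx ↦ ?_⟩
  by_contra! hcon
  have hxC : x ∉ C := fun h ↦ hirr x (hcon x h)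
  have hmem : (insert x C).card ∈ T := by
    refine ⟨insert x C, ?_, ?_, rfl⟩
    · intro y hy
      rcases Finset.mem_insert.1 hy with rfl | hy
      exacts [hx, h1 y hy]
    · intro y hy z hz hyz
      rcases Finset.mem_insert.1 hy with rfl | hy' <;> rcases Finset.mem_insert.1 hz with rfl | hz'
      · exact absurd rfl hyz
      · exact hcon z hz'
      · exact hr _ _ (hcon y hy')
      · exact h2 y hy' z hz' hyz
  have := le_csSup hb hmem
  rw [Finset.card_insert_of_notMem hxC, ← h3] at this
  omega

theorem integral_eval_infinitePi (Γ : Type*) {A : Type*} [MeasurableSpace A] (κ : Measure A)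
    [IsProbabilityMeasure κ] {f : A → ℝ} (hf : Measurable f) (g : Γ) :
    ∫ y, f (y g) ∂(Measure.infinitePi fun _ : Γ ↦ κ) = ∫ a, f a ∂κ := by
  have h1 := measurePreserving_eval_infinitePi (fun _ : Γ ↦ κ) g
  have h2 := integral_map (μ := Measure.infinitePi fun _ : Γ ↦ κ) h1.aemeasurable
    hf.aestronglyMeasurable
  rw [h1.map_eq] at h2
  exact h2.symm

/-- A volume argument: typical colourings have sup-metric balls of exponentially small probability,
while the balls around a maximal separated set of them cover more than half of the probability. The
scale ε is fixed before `p`, so it does not depend on the neighbourhoods later used in the entropy.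
-/
theorem eventually_exists_separated {Γ : Type*} [Group Γ] (S : SoficApproximation Γ)
    (hV : Tendsto (fun n ↦ Fintype.card (S.V n)) atTop atTop)
    {A : Type*} [MetricSpace A] [SecondCountableTopology A] [Nonempty A]
    [MeasurableSpace A] [BorelSpace A] (κ : Measure A) [IsProbabilityMeasure κ] {t : ℝ}
    (ht : (t : EReal) < shannonEntropy κ) :
    ∃ ε : ℝ, 0 < ε ∧ ∀ p : ∀ n, (S.V n → A) → Prop, Improbable S κ (fun n x ↦ ¬ p n x) →
      ∀ᶠ n in atTop, ∃ C : Finset (S.V n → A), (∀ x ∈ C, p n x) ∧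
        (∀ x ∈ C, ∀ y ∈ C, x ≠ y → ∃ v, ε < dist (x v) (y v)) ∧
        Real.exp (t * Fintype.card (S.V n)) ≤ C.card := by
  classical
  obtain ⟨ε, hε, g, M, hg, hgM, htg, hball⟩ := exists_bounded_information κ ht
  refine ⟨ε, hε, fun p hp ↦ ?_⟩
  set m := ∫ x, g x ∂κ with hm
  -- The midpoint leaves room on both sides: averages of `g` fall below `t'` with small probability,
  -- and the gain `exp((t' - t)|V_n|)` absorbs the factor 2 lost by covering only half of the space.
  set t' := (t + m) / 2 with ht'
  have hint := integral_eval_infinitePi Γ κ hg 1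
  have hav := improbable_average (S := S) (κ := κ) hV (F := fun y ↦ g (y 1))
    (hg.comp (measurable_pi_apply _)) (K := {1}) (fun x y h ↦ by simp [h 1 (by simp)])
    (fun x ↦ hgM _) (η := (m - t) / 2) (by linarith)
  rw [hint] at hav
  have hV' : Tendsto (fun n ↦ (Fintype.card (S.V n) : ℝ) * (t' - t)) atTop atTop :=
    (tendsto_natCast_atTop_atTop.comp hV).atTop_mul_const (by linarith)
  filter_upwards [(hp.or hav).eventually (gt_mem_nhds (half_pos one_pos)),
    hV'.eventually_gt_atTop (Real.log 2)] with n hn hlog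
  -- The negation bounds the size of separated sets, which is what guarantees a maximal one.
  by_contra! hcon
  have hc := card_V_pos (S := S) n
  set c : ℝ := (Fintype.card (S.V n) : ℝ)
  let G : (S.V n → A) → Prop := fun x ↦ p n x ∧ t' * c ≤ ∑ v, g (x v)
  obtain ⟨C, hC1, hC2, hC3⟩ := exists_maximal_separated G
    (fun x y ↦ ∃ v, ε < dist (x v) (y v)) (N := Real.exp (t * c))
    (fun C h1 h2 ↦ (hcon C (fun x hx ↦ (h1 x hx).1) h2).le)
    (fun x y ⟨v, hv⟩ ↦ ⟨v, by rwa [dist_comm]⟩)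
    (fun x ⟨v, hv⟩ ↦ by rw [dist_self] at hv; linarith)
  have hP : 1 / 2 < (colouring S κ n).real {x | G x} := by
    have h1 : (colouring S κ n).real {x | G x}ᶜ < 1 / 2 := by
      refine lt_of_le_of_lt (measureReal_mono fun x hx ↦ ?_) hn
      by_contra hcon'
      simp only [Set.mem_ofPred_eq, not_or, not_not, not_le] at hcon'
      refine hx ⟨hcon'.1, ?_⟩
      have h2 : ∑ v, g (pullback S x v 1) = ∑ v, g (x v) :=
        Equiv.sum_comp (S.σ n 1⁻¹) fun v ↦ g (x v)
      have h3 := (abs_lt.1 hcon'.2).1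
      rw [h2] at h3
      have h4 : t' < c⁻¹ * ∑ v, g (x v) := by linarith
      rw [inv_mul_eq_div, lt_div_iff₀ hc] at h4
      exact h4.le
    have h2 := measureReal_union_le (μ := colouring S κ n) {x | G x} {x | G x}ᶜ
    rw [Set.union_compl_self, probReal_univ] at h2
    linarith
  have hballs : ∀ x ∈ C, (colouring S κ n).real {y | ∀ v, dist (y v) (x v) ≤ ε} ≤
      Real.exp (-(t' * c)) := by
    intro x hx
    refine ENNReal.toReal_le_of_le_ofReal (Real.exp_pos _).le ?_
    have h1 : {y : S.V n → A | ∀ v, dist (y v) (x v) ≤ ε} =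
        Set.univ.pi fun v ↦ Metric.closedBall (x v) ε := by
      ext y; simp [Set.mem_pi]
    rw [h1, colouring, Measure.infinitePi_eq_pi, Measure.pi_pi]
    calc ∏ v, κ (Metric.closedBall (x v) ε) ≤ ∏ v, ENNReal.ofReal (Real.exp (-g (x v))) :=
          Finset.prod_le_prod' fun v _ ↦ hball _
      _ = ENNReal.ofReal (Real.exp (-∑ v, g (x v))) := by
          rw [← ENNReal.ofReal_prod_of_nonneg fun v _ ↦ (Real.exp_pos _).le, ← Real.exp_sum,
            Finset.sum_neg_distrib]
      _ ≤ _ := ENNReal.ofReal_le_ofReal (Real.exp_le_exp.2 (neg_le_neg (hC1 x hx).2))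
  have hcover : {x | G x} ⊆ ⋃ x ∈ C, {y | ∀ v, dist (y v) (x v) ≤ ε} := by
    intro y hy
    obtain ⟨x, hx, hxy⟩ := hC3 y hy
    push Not at hxy
    exact Set.mem_iUnion₂.2 ⟨x, hx, hxy⟩
  have h1 : (colouring S κ n).real {x | G x} ≤ C.card * Real.exp (-(t' * c)) :=
    calc _ ≤ ∑ x ∈ C, (colouring S κ n).real {y | ∀ v, dist (y v) (x v) ≤ ε} :=
          (measureReal_mono hcover (measure_ne_top _ _)).trans (measureReal_biUnion_finset_le _ _)
      _ ≤ ∑ _x ∈ C, Real.exp (-(t' * c)) := Finset.sum_le_sum hballs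
      _ = _ := by simp
  have h2 := hcon C (fun x hx ↦ (hC1 x hx).1) hC2
  have h3 : (C.card : ℝ) * Real.exp (-(t' * c)) ≤ Real.exp (-Real.log 2) := by
    calc _ ≤ Real.exp (t * c) * Real.exp (-(t' * c)) := by gcongr
      _ = Real.exp (-(c * (t' - t))) := by rw [← Real.exp_add]; ring_nf
      _ ≤ _ := Real.exp_le_exp.2 (neg_le_neg hlog.le)
  rw [Real.exp_neg (Real.log 2), Real.exp_log two_pos] at h3
  linarith

/-! ### Sofic approximations of growing size -/

/-- `n + 1` copies of the `n`-th approximation. -/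
def SoficApproximation.copies {Γ : Type*} [Group Γ] (S : SoficApproximation Γ) :
    SoficApproximation Γ :=
  have key : ∀ (n : ℕ) (p : S.V n → Prop),
      (Set.ncard {v : S.V n × Fin (n + 1) | p v.1} : ℝ) / Fintype.card (S.V n × Fin (n + 1)) =
        (Set.ncard {v | p v} : ℝ) / Fintype.card (S.V n) := fun n p ↦ by
    have h1 : {v : S.V n × Fin (n + 1) | p v.1} = {v | p v} ×ˢ Set.univ := by ext; simp
    rw [h1, Set.ncard_prod, Set.ncard_univ, Nat.card_eq_fintype_card, Fintype.card_prod,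
      Nat.cast_mul, Nat.cast_mul]
    exact mul_div_mul_right _ _ (by simp; positivity)
  { V := fun n ↦ S.V n × Fin (n + 1)
    σ := fun n g ↦ (S.σ n g).prodCongr (Equiv.refl _)
    asymptotically_multiplicative := fun g h ↦ by
      refine (S.asymptotically_multiplicative g h).congr fun n ↦ ?_
      rw [← key]
      simp [Prod.ext_iff]
    asymptotically_free := fun g hg ↦ by
      refine (S.asymptotically_free g hg).congr fun n ↦ ?_
      rw [← key]
      simp [Prod.ext_iff] }

/-- A finite group may have sofic approximations of bounded size, to which the law of large numbers
does not apply; taking copies keeps all densities and removes this obstacle. -/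
theorem tendsto_card_copies {Γ : Type*} [Group Γ] (S : SoficApproximation Γ) :
    Tendsto (fun n ↦ Fintype.card (S.copies.V n)) atTop atTop := by
  refine tendsto_atTop_mono (fun n ↦ ?_) tendsto_id
  have h1 : Fintype.card (S.copies.V n) = Fintype.card (S.V n × Fin (n + 1)) := rfl
  have h2 : 0 < Fintype.card (S.V n) := Fintype.card_pos
  rw [h1, Fintype.card_prod, Fintype.card_fin, id]
  nlinarith

/-! ### Separated sets and empirical distributions -/

theorem card_le_sep {X V : Type*} (d : MetricSpace X) [Fintype V] (ε : ℝ≥0) (S : Set (V → X))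
    (C : Finset (V → X)) (hC : ∀ x ∈ C, x ∈ S)
    (hsep : ∀ x ∈ C, ∀ y ∈ C, x ≠ y → ∃ v, (ε : ℝ) < d.dist (x v) (y v)) :
    (C.card : ℕ∞) ≤ sep d ε S := by
  let := d
  have h : Metric.IsSeparated ε (C : Set (V → X)) := by
    intro x hx y hy hxy
    obtain ⟨v, hv⟩ := hsep x hx y hy hxy
    refine lt_of_lt_of_le ?_ (edist_le_pi_edist x y v)
    rw [edist_dist, ← ENNReal.ofReal_coe_nnreal]
    exact (ENNReal.ofReal_lt_ofReal_iff_of_nonneg ε.2).2 hv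
  have := h.encard_le_packingNumber (A := S) hC
  rwa [Set.encard_coe_eq_coe_finsetCard] at this

theorem sep_le {X V : Type*} (d : MetricSpace X) [Fintype V] (ε : ℝ≥0) (S : Set (V → X)) {N : ℝ}
    (hN : ∀ C : Finset (V → X), (∀ x ∈ C, x ∈ S) →
      (∀ x ∈ C, ∀ y ∈ C, x ≠ y → ∃ v, (ε : ℝ) < d.dist (x v) (y v)) → (C.card : ℝ) ≤ N) :
    sep d ε S ≤ ⌊N⌋₊ := by
  let := d
  refine iSup₂_le fun C hC ↦ iSup_le fun hsep ↦ ?_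
  by_contra! hlt
  -- The packing number ranges over possibly infinite sets; a subset with exactly one point too many
  -- is finite and already contradicts the bound.
  obtain ⟨C', hC', hcard⟩ := Set.exists_subset_encard_eq (Order.add_one_le_of_lt hlt)
  have hfin : C'.Finite := Set.finite_of_encard_eq_coe (k := ⌊N⌋₊ + 1) (by exact_mod_cast hcard)
  lift C' to Finset (V → X) using hfin
  have h := hN C' (fun x hx ↦ hC (hC' hx)) fun x hx y hy hxy ↦ by
    by_contra! hcon
    refine absurd (hsep (hC' hx) (hC' hy) hxy) (not_lt.2 ?_)
    refine edist_pi_le_iff.2 fun v ↦ ?_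
    rw [edist_dist, ← ENNReal.ofReal_coe_nnreal]
    exact ENNReal.ofReal_le_ofReal (hcon v)
  rw [Set.encard_coe_eq_coe_finsetCard] at hcard
  have h2 : C'.card = ⌊N⌋₊ + 1 := by exact_mod_cast hcard
  have := Nat.le_floor h
  omega

theorem integral_empiricalDistribution {X V : Type*} [MeasurableSpace X] [Fintype V] [Nonempty V]
    (φ : V → X) {f : X → ℝ} (hf : StronglyMeasurable f) :
    ∫ x, f x ∂(empiricalDistribution φ : Measure X) = (Fintype.card V : ℝ)⁻¹ * ∑ v, f (φ v) := by
  have h : (empiricalDistribution φ : Measure X) =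
      (Fintype.card V : ℝ≥0∞)⁻¹ • ∑ v, Measure.dirac (φ v) := rfl
  rw [h, integral_smul_measure, integral_finsetSum_measure fun v _ ↦ ?_]
  · simp [integral_dirac' f _ hf]
  · exact integrable_dirac' hf (by simp)

/-! ### The product uniformity -/

theorem exists_finset_of_mem_uniformity {Γ A : Type*} [MetricSpace A] {s : Set ((Γ → A) × (Γ → A))}
    (hs : s ∈ uniformity (Γ → A)) :
    ∃ (K : Finset Γ) (ε : ℝ), 0 < ε ∧ ∀ x y, (∀ k ∈ K, dist (x k) (y k) < ε) → (x, y) ∈ s := by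
  rw [Pi.uniformity] at hs
  obtain ⟨⟨I, r⟩, ⟨hI, hr⟩, h⟩ := (HasBasis.iInf' fun i : Γ ↦
    (Metric.uniformity_basis_dist (α := A)).comap
      fun a : (Γ → A) × (Γ → A) ↦ (a.1 i, a.2 i)).mem_iff.1 hs
  have hev : ∀ᶠ ε in 𝓝[>] (0 : ℝ), 0 < ε ∧ ∀ i ∈ I, ε < r i := by
    refine eventually_mem_nhdsWithin.and ((eventually_all_finite hI).2 fun i hi ↦ ?_)
    exact mem_nhdsWithin_of_mem_nhds (gt_mem_nhds (hr i hi))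
  obtain ⟨ε, hε, hε'⟩ := hev.exists
  refine ⟨hI.toFinset, ε, hε, fun x y hxy ↦ h (Set.mem_iInter₂.2 fun i hi ↦ ?_)⟩
  exact (hxy i (hI.mem_toFinset.2 hi)).trans (hε' i hi)

section CompatibleMetric

variable {Γ A : Type*} [MetricSpace A] [CompactSpace A] (d : MetricSpace (Γ → A))
  (hd : d.toUniformSpace.toTopologicalSpace = Pi.topologicalSpace)

include hd

/-- A compact Hausdorff space has only one compatible uniformity. Every admissible `d` is thus
uniformly comparable with finitely many coordinate distances, which is why the choice of metric is
immaterial. -/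
theorem uniformSpace_eq_pi : d.toUniformSpace = Pi.uniformSpace fun _ : Γ ↦ A :=
  unique_uniformity_of_compact (t := Pi.topologicalSpace) hd rfl

theorem exists_coords_imp_dist_lt {ε : ℝ} (hε : 0 < ε) :
    ∃ (K : Finset Γ) (ε' : ℝ), 0 < ε' ∧
      ∀ x y : Γ → A, (∀ k ∈ K, dist (x k) (y k) < ε') → d.dist x y < ε := by
  have h : {p : (Γ → A) × (Γ → A) | d.dist p.1 p.2 < ε} ∈ uniformity (Γ → A) := by
    rw [← uniformSpace_eq_pi d hd]
    exact (@Metric.mem_uniformity_dist _ d.toPseudoMetricSpace _).2 ⟨ε, hε, fun _ _ h ↦ h⟩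
  exact exists_finset_of_mem_uniformity h

theorem exists_dist_imp_coord_lt (g : Γ) {ε : ℝ} (hε : 0 < ε) :
    ∃ δ : ℝ, 0 < δ ∧ ∀ x y : Γ → A, d.dist x y < δ → dist (x g) (y g) < ε := by
  have h : {p : (Γ → A) × (Γ → A) | dist (p.1 g) (p.2 g) < ε} ∈ uniformity (Γ → A) := by
    have := Pi.uniformContinuous_proj (fun _ : Γ ↦ A) g
    exact this (Metric.dist_mem_uniformity hε)
  rw [← uniformSpace_eq_pi d hd] at h
  obtain ⟨δ, hδ, h'⟩ := (@Metric.mem_uniformity_dist _ d.toPseudoMetricSpace _).1 h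
  exact ⟨δ, hδ, fun x y hxy ↦ h' hxy⟩

theorem exists_dist_bound : ∃ D : ℝ, ∀ x y : Γ → A, d.dist x y ≤ D := by
  have hc : @CompactSpace (Γ → A) d.toUniformSpace.toTopologicalSpace := by
    rw [hd]; infer_instance
  have hb := @Metric.isBounded_of_compactSpace _ Set.univ d.toPseudoMetricSpace hc
  obtain ⟨D, hD⟩ := (@Metric.isBounded_iff _ d.toPseudoMetricSpace _).1 hb
  exact ⟨D, fun x y ↦ hD (Set.mem_univ x) (Set.mem_univ y)⟩

end CompatibleMetric

/-! ### The lower bound -/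

theorem average_le_of_le_off {V : Type*} [Fintype V] [Nonempty V] (a : V → ℝ) (p : V → Prop)
    {α D : ℝ} (hα : 0 ≤ α) (hp : ∀ v, ¬ p v → a v ≤ α) (hD : ∀ v, a v ≤ D) :
    (Fintype.card V : ℝ)⁻¹ * ∑ v, a v ≤ α + D * (Set.ncard {v | p v} / Fintype.card V) := by
  classical
  have hc : (0 : ℝ) < Fintype.card V := by exact_mod_cast Fintype.card_pos
  have h1 : ∑ v, a v ≤ ∑ v, (α + if p v then D else 0) := by
    refine Finset.sum_le_sum fun v _ ↦ ?_
    by_cases h : p v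
    · simpa [h] using (hD v).trans (by linarith)
    · simpa [h] using hp v h
  have h2 : ∑ v, (α + if p v then D else 0) =
      Fintype.card V * α + D * (Set.ncard {v | p v} : ℝ) := by
    have h3 : (Set.ncard {v | p v} : ℝ) = (Finset.univ.filter p).card := by
      rw [← Set.ncard_coe_finset]; simp
    rw [h3, Finset.sum_add_distrib, ← Finset.sum_filter]
    simp [mul_comm]
  rw [h2] at h1
  rw [inv_mul_le_iff₀ hc]
  refine h1.trans (le_of_eq ?_)
  field_simp

section LowerBound

variable {Γ A : Type*} [Group Γ] [MetricSpace A] [CompactSpace A] (S : SoficApproximation Γ)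

/-- The coordinates at `f` of the two points compared are `x(σ(f⁻¹)σ(g)v)` and `x(σ(f⁻¹g)v)`. They
agree wherever σ is multiplicative at `(f⁻¹, g)`, whatever the colouring, so the bound is uniform in
`x`. -/
theorem eventually_pullback_mem_pseudoOrbits (d : MetricSpace (Γ → A))
    (hd : d.toUniformSpace.toTopologicalSpace = Pi.topologicalSpace) {δ : ℝ} (hδ : 0 < δ)
    (F : Finset Γ) :
    ∀ᶠ n in atTop, ∀ x : S.V n → A, pullback S x ∈ pseudoOrbits (shift Γ A) d (S.σ n) δ F := by
  obtain ⟨L, ε, hε, hL⟩ := exists_coords_imp_dist_lt d hd (half_pos hδ)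
  obtain ⟨D, hD⟩ := exists_dist_bound d hd
  have hF : ∀ g ∈ F, ∀ᶠ n in atTop, ∀ x : S.V n → A, (Fintype.card (S.V n) : ℝ)⁻¹ *
      ∑ v, d.dist (pullback S x (S.σ n g v)) (shift Γ A g (pullback S x v)) < δ := by
    intro g _
    have hneg : Negligible S fun n v ↦ ∃ f ∈ L, S.σ n (f⁻¹ * g) v ≠ S.σ n f⁻¹ (S.σ n g v) :=
      Negligible.exists_finset L fun f _ ↦ negligible_not_mul f⁻¹ g
    have hneg' := Tendsto.const_mul D hneg
    rw [mul_zero] at hneg'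
    filter_upwards [hneg'.eventually (gt_mem_nhds (half_pos hδ))] with n hn x
    refine (average_le_of_le_off _ (fun v ↦ ∃ f ∈ L, S.σ n (f⁻¹ * g) v ≠ S.σ n f⁻¹ (S.σ n g v))
      (half_pos hδ).le (fun v hv ↦ (hL _ _ fun f hf ↦ ?_).le) (fun v ↦ hD _ _)).trans_lt
        (by linarith)
    push Not at hv
    have h1 : pullback S x (S.σ n g v) f = shift Γ A g (pullback S x v) f := by
      change x (S.σ n f⁻¹ (S.σ n g v)) = x (S.σ n (g⁻¹ * f)⁻¹ v)
      rw [mul_inv_rev, inv_inv, hv f hf]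
    rw [h1, dist_self]
    exact hε
  exact ((Finset.eventually_all F).2 hF).mono fun n hn x g hg ↦ hn g hg x

variable [MeasurableSpace A] [BorelSpace A] [Countable Γ] (κ : Measure A) [IsProbabilityMeasure κ]

/-- By uniform continuity `f` is within η/3 of the function obtained by freezing all coordinates
outside a finite set, and `improbable_average` applies to the latter. -/
theorem improbable_integral_far [Nonempty A]
    (hV : Tendsto (fun n ↦ Fintype.card (S.V n)) atTop atTop)
    (f : BoundedContinuousFunction (Γ → A) ℝ) {η : ℝ} (hη : 0 < η) :
    Improbable S κ fun _ x ↦ ¬ dist (∫ y, f y ∂(empiricalDistribution (pullback S x) :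
      Measure (Γ → A))) (∫ y, f y ∂(bernoulliMeasure Γ κ : Measure (Γ → A))) < η := by
  classical
  obtain ⟨a₀⟩ := (inferInstance : Nonempty A)
  have huc : UniformContinuous f := CompactSpace.uniformContinuous_of_continuous f.continuous
  obtain ⟨K, ε, hε, hK⟩ := exists_finset_of_mem_uniformity
    (huc (Metric.dist_mem_uniformity (show 0 < η / 3 by linarith)))
  let trunc : (Γ → A) → Γ → A := fun y g ↦ if g ∈ K then y g else a₀
  have htrunc : Measurable trunc := measurable_pi_lambda _ fun g ↦ by
    by_cases h : g ∈ K
    · simpa [trunc, h] using measurable_pi_apply _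
    · simp [trunc, h]
  let F : (Γ → A) → ℝ := fun y ↦ f (trunc y)
  have hF : Measurable F := f.continuous.measurable.comp htrunc
  have hFK : DependsOn F (K : Set Γ) := fun x y hxy ↦ by
    have : trunc x = trunc y := by
      funext g
      by_cases h : g ∈ K
      · simpa [trunc, h] using hxy g h
      · simp [trunc, h]
    simp [F, this]
  have hclose : ∀ y, |f y - F y| ≤ η / 3 := fun y ↦ by
    have h : (y, trunc y) ∈ (fun p : (Γ → A) × (Γ → A) ↦ (f p.1, f p.2)) ⁻¹'
        {p | dist p.1 p.2 < η / 3} := hK _ _ fun k hk ↦ by simp [trunc, hk, hε]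
    exact (le_of_lt h)
  have hFb : ∀ y, |F y| ≤ ‖f‖ := fun y ↦ f.norm_coe_le_norm _
  refine (improbable_average (S := S) (κ := κ) hV hF hFK hFb
    (show 0 < η / 3 by linarith)).mono fun n x hx ↦ ?_
  by_contra! hlt
  apply hx
  rw [integral_empiricalDistribution _ f.continuous.stronglyMeasurable, Real.dist_eq]
  have h1 : |(Fintype.card (S.V n) : ℝ)⁻¹ * ∑ v, f (pullback S x v) -
      (Fintype.card (S.V n) : ℝ)⁻¹ * ∑ v, F (pullback S x v)| ≤ η / 3 := by
    have hc := card_V_pos (S := S) n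
    rw [← mul_sub, abs_mul, abs_of_pos (inv_pos.2 hc), ← Finset.sum_sub_distrib,
      inv_mul_le_iff₀ hc]
    refine (Finset.abs_sum_le_sum_abs _ _).trans ?_
    exact (Finset.sum_le_sum fun v _ ↦ hclose _).trans (by simp)
  have h2 : |∫ y, F y ∂(bernoulliMeasure Γ κ : Measure (Γ → A)) -
      ∫ y, f y ∂(bernoulliMeasure Γ κ : Measure (Γ → A))| ≤ η / 3 := by
    have hi : Integrable F (bernoulliMeasure Γ κ : Measure (Γ → A)) :=
      Integrable.of_bound hF.aestronglyMeasurable ‖f‖ (ae_of_all _ hFb)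
    rw [abs_sub_comm, ← integral_sub (f.integrable _) hi]
    have := norm_integral_le_of_norm_le_const (μ := (bernoulliMeasure Γ κ : Measure (Γ → A)))
      (ae_of_all _ fun y ↦ (Real.norm_eq_abs (f y - F y)).le.trans (hclose y))
    simpa using this
  have h3 : (bernoulliMeasure Γ κ : Measure (Γ → A)) = Measure.infinitePi fun _ : Γ ↦ κ := rfl
  rw [h3] at h2 ⊢
  rw [abs_lt] at hlt ⊢
  rw [abs_le] at h1 h2
  constructor <;> linarith [h1.1, h1.2, h2.1, h2.2, hlt.1, hlt.2]

/-- The sets of measures missed only with vanishing probability form a filter. Convergence of this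
filter to the product measure can be tested on integrals of bounded continuous functions. -/
theorem improbable_empiricalDistribution_notMem [Nonempty A]
    (hV : Tendsto (fun n ↦ Fintype.card (S.V n)) atTop atTop)
    {O : Set (ProbabilityMeasure (Γ → A))} (hO : IsOpen O) (hκ : bernoulliMeasure Γ κ ∈ O) :
    Improbable S κ fun _ x ↦ empiricalDistribution (pullback S x) ∉ O := by
  let 𝓕 : Filter (ProbabilityMeasure (Γ → A)) :=
    { sets := {O | Improbable S κ fun _ x ↦ empiricalDistribution (pullback S x) ∉ O}
      univ_sets := by simp [Improbable]
      sets_of_superset := fun h hst ↦ Improbable.mono h fun _ x hx hxs ↦ hx (hst hxs)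
      inter_sets := fun h h' ↦ (Improbable.or h h').mono fun n x hx ↦ by
        by_contra! hcon
        exact hx ⟨hcon.1, hcon.2⟩ }
  have h : Tendsto id 𝓕 (𝓝 (bernoulliMeasure Γ κ)) := by
    refine ProbabilityMeasure.tendsto_iff_forall_integral_tendsto.2 fun f ↦ ?_
    exact Metric.tendsto_nhds.2 fun η hη ↦ improbable_integral_far S κ hV f hη
  exact h (hO.mem_nhds hκ)

/-- Separated colourings pull back to separated orbit maps, since the coordinate at the identity
recovers the colours. -/
theorem le_measureSoficEntropy (hV : Tendsto (fun n ↦ Fintype.card (S.V n)) atTop atTop)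
    (d : MetricSpace (Γ → A)) (hd : d.toUniformSpace.toTopologicalSpace = Pi.topologicalSpace)
    {t : ℝ} (ht : (t : EReal) < shannonEntropy κ) :
    (t : EReal) ≤ measureSoficEntropy S (shift Γ A) d (bernoulliMeasure Γ κ) := by
  classical
  have : Nonempty A := nonempty_of_isProbabilityMeasure κ
  obtain ⟨ε₀, hε₀, hsep⟩ := eventually_exists_separated S hV κ ht
  obtain ⟨δ₀, hδ₀, hcoord⟩ := exists_dist_imp_coord_lt d hd 1 hε₀
  let ε : ℝ≥0 := ⟨δ₀ / 2, by positivity⟩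
  have hεδ : (ε : ℝ) < δ₀ := by change δ₀ / 2 < δ₀; linarith
  have hε : 0 < ε := by rw [← NNReal.coe_pos]; change 0 < δ₀ / 2; linarith
  refine le_iSup₂_of_le ε hε (le_iInf₂ fun δ hδ ↦ le_iInf fun F ↦ le_iInf fun O ↦
    le_iInf₂ fun hO hκ ↦ le_limsup_of_frequently_le' (Eventually.frequently ?_))
  have himp : Improbable S κ fun n x ↦
      ¬ pullback S x ∈ measurePseudoOrbits (shift Γ A) d (S.σ n) δ F O := by
    refine (improbable_empiricalDistribution_notMem S κ hV hO hκ).mono_eventually ?_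
    filter_upwards [eventually_pullback_mem_pseudoOrbits S d hd hδ F] with n hn x hx hxO
    exact hx ⟨hn x, hxO⟩
  filter_upwards [hsep _ himp] with n ⟨C, hC1, hC2, hC3⟩
  have hc := card_V_pos (S := S) n
  have hfar : ∀ x ∈ C, ∀ y ∈ C, x ≠ y →
      ∃ v, (ε : ℝ) < d.dist (pullback S x v) (pullback S y v) := by
    intro x hx y hy hxy
    obtain ⟨v, hv⟩ := hC2 x hx y hy hxy
    -- `σ(1)` need not be the identity, so the vertex is moved back by this permutation.
    refine ⟨(S.σ n 1⁻¹).symm v, hεδ.trans_le ?_⟩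
    by_contra! hlt
    have := hcoord _ _ hlt
    simp only [pullback, Equiv.apply_symm_apply] at this
    linarith
  have hinj : Set.InjOn (fun x v ↦ pullback S x v) (C : Set (S.V n → A)) := by
    intro x hx y hy hxy
    by_contra hne
    obtain ⟨v, hv⟩ := hfar x hx y hy hne
    have h1 : pullback S x v = pullback S y v := congrFun hxy v
    rw [h1, d.dist_self] at hv
    exact absurd hv (not_lt.2 ε.2)
  have hle := card_le_sep d ε (measurePseudoOrbits (shift Γ A) d (S.σ n) δ F O)
    (C.image fun x v ↦ pullback S x v) (by
      intro y hy
      obtain ⟨x, hx, rfl⟩ := Finset.mem_image.1 hy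
      exact hC1 x hx) (by
      intro y hy z hz hyz
      obtain ⟨x, hx, rfl⟩ := Finset.mem_image.1 hy
      obtain ⟨x', hx', rfl⟩ := Finset.mem_image.1 hz
      exact hfar x hx x' hx' fun h ↦ hyz (by rw [h]))
  rw [Finset.card_image_of_injOn hinj] at hle
  rw [EReal.le_div_iff_mul_le (by exact_mod_cast hc) (by exact EReal.natCast_ne_top _)]
  calc (t : EReal) * (Fintype.card (S.V n) : EReal)
      = ENNReal.log (ENNReal.ofReal (Real.exp (t * Fintype.card (S.V n)))) := by
        rw [ENNReal.log_ofReal_of_pos (Real.exp_pos _), Real.log_exp]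
        push_cast; rfl
    _ ≤ _ := by
        refine ENNReal.log_monotone ?_
        refine le_trans (ENNReal.ofReal_le_ofReal hC3) ?_
        rw [ENNReal.ofReal_natCast]
        exact_mod_cast ENat.toENNReal_le.2 hle

end LowerBound

/-! ### The upper bound -/

/-- The weights of the alphabet consisting of the points of `T` and one symbol for its complement. -/
noncomputable def letterWeight {A : Type*} [MeasurableSpace A] (κ : Measure A) (T : Finset A)
    (θ : ℝ) (q : Option T) : ℝ := q.elim θ fun b ↦ κ.real {(b : A)}

theorem letterWeight_pos {A : Type*} [MeasurableSpace A] {κ : Measure A} {T : Finset A}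
    (hT : ∀ b ∈ T, 0 < κ.real {b}) {θ : ℝ} (hθ : 0 < θ) (q : Option T) :
    0 < letterWeight κ T θ q := by
  rcases q with _ | b
  · exact hθ
  · exact hT b b.2

theorem sum_letterWeight_le {A : Type*} [MeasurableSpace A] [MeasurableSingletonClass A]
    (κ : Measure A) [IsProbabilityMeasure κ] (T : Finset A) (θ : ℝ) :
    ∑ q, letterWeight κ T θ q ≤ 1 + θ := by
  have h1 : ∑ b : T, κ.real {(b : A)} ≤ 1 := by
    rw [Finset.sum_coe_sort T fun b ↦ κ.real {b}, sum_measureReal_singleton]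
    exact measureReal_le_one
  simp only [Fintype.sum_option, letterWeight, Option.elim]
  linarith

/-- Weak* neighbourhoods control only continuous functions, so the discontinuous letter cost is
dominated by a continuous `F`: `M` times a cutoff vanishing on `T`, plus bumps around the points of
`T` with heights equal to the letter costs. As the radius shrinks, the bump integrals tend to the
atom masses. -/
theorem exists_continuous_cost {A : Type*} [MetricSpace A] [CompactSpace A] [MeasurableSpace A]
    [BorelSpace A] (κ : Measure A) [IsProbabilityMeasure κ] (T : Finset A)
    {θ M ρ : ℝ} (hθ : 0 < θ) (hM : 0 ≤ M) (hρ : 0 < ρ) :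
    ∃ (ℓ : A → Option T) (F : A → ℝ), Continuous F ∧
      (∀ a a', ℓ a = ℓ a' → ℓ a ≠ none → dist a a' < ρ) ∧
      (∀ a, ℓ a = none → M ≤ F a) ∧ (∀ a b, ℓ a = some b → -Real.log (κ.real {(b : A)}) ≤ F a) ∧
      ∫ a, F a ∂κ ≤ M * κ.real (T : Set A)ᶜ +
        ∑ b ∈ T, κ.real {b} * -Real.log (κ.real {b}) + θ := by
  classical
  let c : A → ℝ := fun b ↦ -Real.log (κ.real {b})
  have hc : ∀ b, 0 ≤ c b := fun b ↦ by
    have := Real.log_nonpos (measureReal_nonneg (μ := κ) (s := {b})) measureReal_le_one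
    simp only [c]; linarith
  have hC : 0 ≤ ∑ b ∈ T, c b := Finset.sum_nonneg fun b _ ↦ hc b
  have hballs : ∀ b ∈ T, ∀ᶠ r in 𝓝[>] (0 : ℝ), κ.real (Metric.closedBall b (2 * r)) <
      κ.real {b} + θ / (∑ b ∈ T, c b + 1) := by
    intro b _
    have h1 : Tendsto (fun r ↦ κ (Metric.closedBall b r)) (𝓝[>] 0)
        (𝓝 (κ (⋂ r > (0 : ℝ), Metric.closedBall b r))) :=
      tendsto_measure_biInter_gt (fun r _ ↦ Metric.isClosed_closedBall.measurableSet.nullMeasurableSet)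
        (fun i j _ hij ↦ Metric.closedBall_subset_closedBall hij) ⟨1, one_pos, measure_ne_top _ _⟩
    have h2 : ⋂ r > (0 : ℝ), Metric.closedBall b r = {b} := by
      ext a
      simp only [Set.mem_iInter, Metric.mem_closedBall, Set.mem_singleton_iff]
      refine ⟨fun h ↦ dist_le_zero.1 (le_of_forall_gt_imp_ge_of_dense h), ?_⟩
      rintro rfl r hr
      simpa using le_of_lt hr
    rw [h2] at h1
    have h3 := (ENNReal.tendsto_toReal (measure_ne_top κ {b})).comp h1
    have h4 : Tendsto (fun r : ℝ ↦ 2 * r) (𝓝[>] 0) (𝓝[>] 0) := by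
      refine tendsto_nhdsWithin_iff.2 ⟨?_, ?_⟩
      · have : Tendsto (fun r : ℝ ↦ 2 * r) (𝓝 0) (𝓝 (2 * 0)) := tendsto_id.const_mul 2
        rw [mul_zero] at this
        exact this.mono_left nhdsWithin_le_nhds
      · filter_upwards [self_mem_nhdsWithin] with r hr
        have : (0 : ℝ) < r := hr
        exact (by linarith : (0 : ℝ) < 2 * r)
    exact (h3.comp h4).eventually (gt_mem_nhds (lt_add_of_pos_right _ (by positivity)))
  obtain ⟨r, ⟨hr0, hrρ⟩, hr⟩ := ((eventually_mem_nhdsWithin.and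
    (mem_nhdsWithin_of_mem_nhds (gt_mem_nhds (half_pos hρ)))).and
      ((Finset.eventually_all T).2 hballs)).exists
  have hr0 : 0 < r := hr0
  have hrρ : r < ρ / 2 := hrρ
  let far : A → ℝ := fun a ↦ ∏ b ∈ T, min 1 (dist a b / r)
  let near : A → A → ℝ := fun b a ↦ max 0 (min 1 (2 - dist a b / r))
  let F : A → ℝ := fun a ↦ M * far a + ∑ b ∈ T, c b * near b a
  -- Balls around different points of `T` may overlap; any choice is admissible because `F`
  -- dominates the cost of each ball containing `a`.
  let ℓ : A → Option T := fun a ↦ if h : ∃ b : T, dist a b < r then some h.choose else none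
  have hfar : Continuous far := by simp only [far]; fun_prop
  have hnear : ∀ b, Continuous (near b) := fun b ↦ by simp only [near]; fun_prop
  have hfar0 : ∀ a, 0 ≤ far a := fun a ↦ Finset.prod_nonneg fun b _ ↦
    le_min zero_le_one (by positivity)
  have hfar1 : ∀ a, far a ≤ 1 := fun a ↦ Finset.prod_le_one
    (fun b _ ↦ le_min zero_le_one (by positivity)) fun b _ ↦ min_le_left _ _
  have hnear0 : ∀ b a, 0 ≤ near b a := fun b a ↦ le_max_left _ _
  have hF : Continuous F := by
    refine (continuous_const.mul hfar).add (continuous_finsetSum _ fun b _ ↦ ?_)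
    exact continuous_const.mul (hnear b)
  have hℓ : ∀ a b, ℓ a = some b → dist a b < r := by
    intro a b h
    by_cases hex : ∃ b : T, dist a b < r
    · simp only [ℓ, dif_pos hex, Option.some.injEq] at h
      rw [← h]; exact hex.choose_spec
    · rw [show ℓ a = none from dif_neg hex] at h
      cases h
  refine ⟨ℓ, F, hF, ?_, ?_, ?_, ?_⟩
  · intro a a' h hne
    obtain ⟨b, hb⟩ := Option.ne_none_iff_exists'.1 hne
    have h1 := hℓ a b hb
    have h2 := hℓ a' b (h ▸ hb)
    have h3 := dist_triangle_right a a' b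
    linarith
  · intro a ha
    have h1 : ∀ b ∈ T, min 1 (dist a b / r) = 1 := by
      intro b hb
      by_contra hne
      have h2 : dist a b < r := by
        by_contra! h3
        exact hne (min_eq_left ((one_le_div hr0).2 h3))
      have hex : ∃ b : T, dist a b < r := ⟨⟨b, hb⟩, h2⟩
      rw [show ℓ a = some hex.choose from dif_pos hex] at ha
      cases ha
    have h2 : far a = 1 := Finset.prod_eq_one h1
    have h3 : 0 ≤ ∑ b ∈ T, c b * near b a :=
      Finset.sum_nonneg fun b _ ↦ mul_nonneg (hc b) (hnear0 b a)
    simp only [F, h2]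
    linarith
  · intro a b hab
    have h1 : near b a = 1 := by
      have h2 : dist a b / r < 1 := (div_lt_one hr0).2 (hℓ a b hab)
      simp only [near]
      rw [min_eq_left (by linarith), max_eq_right zero_le_one]
    have h2 : c b * near b a ≤ ∑ b ∈ T, c b * near b a :=
      Finset.single_le_sum (f := fun b ↦ c b * near b a)
        (fun b _ ↦ mul_nonneg (hc b) (hnear0 b a)) b.2
    rw [h1, mul_one] at h2
    have h3 := mul_nonneg hM (hfar0 a)
    simp only [F]
    linarith
  · have hint : ∀ {f : A → ℝ}, Continuous f → Integrable f κ := fun hf ↦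
      hf.integrable_of_hasCompactSupport (HasCompactSupport.of_compactSpace _)
    have h1 : ∫ a, far a ∂κ ≤ κ.real (T : Set A)ᶜ := by
      rw [← integral_indicator_one T.measurableSet.compl]
      refine integral_mono (hint hfar)
        ((integrable_const 1).indicator T.measurableSet.compl) fun a ↦ ?_
      by_cases ha : a ∈ (T : Set A)
      · have : far a = 0 := Finset.prod_eq_zero ha (by simp)
        simp [this, Finset.mem_coe.1 ha]
      · rw [Set.indicator_of_mem (show a ∈ (T : Set A)ᶜ from ha)]
        exact hfar1 a
    have h2 : ∀ b ∈ T, ∫ a, near b a ∂κ ≤ κ.real {b} + θ / (∑ b ∈ T, c b + 1) := by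
      intro b hb
      refine le_trans ?_ (hr b hb).le
      rw [← integral_indicator_one Metric.isClosed_closedBall.measurableSet]
      refine integral_mono (hint (hnear b)) ((integrable_const 1).indicator
        Metric.isClosed_closedBall.measurableSet) fun a ↦ ?_
      by_cases ha : a ∈ Metric.closedBall b (2 * r)
      · rw [Set.indicator_of_mem ha]
        exact max_le zero_le_one (min_le_left _ _)
      · rw [Set.indicator_of_notMem ha]
        rw [Metric.mem_closedBall, not_le, ← lt_div_iff₀ hr0] at ha
        exact max_le le_rfl ((min_le_right _ _).trans (by linarith))
    have h3 : ∫ a, F a ∂κ = M * ∫ a, far a ∂κ + ∑ b ∈ T, c b * ∫ a, near b a ∂κ := by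
      simp only [F]
      rw [integral_add ((hint hfar).const_mul _)
        (integrable_finsetSum _ fun b _ ↦ (hint (hnear b)).const_mul _), integral_const_mul,
        integral_finsetSum _ fun b _ ↦ (hint (hnear b)).const_mul _]
      simp_rw [integral_const_mul]
    have h4 : ∑ b ∈ T, c b * ∫ a, near b a ∂κ ≤
        ∑ b ∈ T, κ.real {b} * c b + (∑ b ∈ T, c b) * (θ / (∑ b ∈ T, c b + 1)) := by
      rw [Finset.sum_mul, ← Finset.sum_add_distrib]
      refine Finset.sum_le_sum fun b hb ↦ ?_
      have := mul_le_mul_of_nonneg_left (h2 b hb) (hc b)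
      linarith
    have h5 : (∑ b ∈ T, c b) * (θ / (∑ b ∈ T, c b + 1)) ≤ θ := by
      rw [← mul_div_assoc, div_le_iff₀ (by positivity)]
      nlinarith
    have h6 := mul_le_mul_of_nonneg_left h1 hM
    rw [h3]
    linarith

theorem card_filter_mul_le {V : Type*} [Fintype V] (a : V → ℝ) (ha : ∀ v, 0 ≤ a v) (δ : ℝ) :
    ((Finset.univ.filter fun v ↦ δ ≤ a v).card : ℝ) * δ ≤ ∑ v, a v := by
  calc ((Finset.univ.filter fun v ↦ δ ≤ a v).card : ℝ) * δ
      = ∑ v ∈ Finset.univ.filter fun v ↦ δ ≤ a v, δ := by simp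
    _ ≤ ∑ v ∈ Finset.univ.filter fun v ↦ δ ≤ a v, a v :=
        Finset.sum_le_sum fun v hv ↦ (Finset.mem_filter.1 hv).2
    _ ≤ _ := Finset.sum_le_sum_of_subset_of_nonneg (Finset.filter_subset _ _) fun v _ _ ↦ ha v

theorem card_filter_comp_perm {V : Type*} [Fintype V] (π : Equiv.Perm V) (p : V → Prop)
    [DecidablePred p] :
    (Finset.univ.filter fun v ↦ p (π v)).card = (Finset.univ.filter p).card := by
  rw [← Finset.card_map π.toEmbedding]
  congr 1
  ext v
  simp only [Finset.mem_map_equiv, Finset.mem_filter, Finset.mem_univ, true_and,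
    Equiv.apply_symm_apply]

/-- For an approximate orbit, `φ(v)(k)` is close to `φ(σ(k⁻¹)v)(1)`, so the letters at the identity
coordinate determine `φ(v)` on `K` up to small error. Where a needed letter is missing or the orbit
error is large, the quantized `K`-coordinates are stored instead. -/
theorem measureSoficEntropy_le {Γ A : Type*} [Group Γ] [Countable Γ] [MetricSpace A]
    [CompactSpace A] [MeasurableSpace A] [BorelSpace A] (S : SoficApproximation Γ)
    (κ : Measure A) [IsProbabilityMeasure κ] (d : MetricSpace (Γ → A))
    (hd : d.toUniformSpace.toTopologicalSpace = Pi.topologicalSpace)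
    (hH : shannonEntropy κ ≠ ⊤) {t : ℝ} (ht : (shannonEntropy κ).toReal < t) :
    measureSoficEntropy S (shift Γ A) d (bernoulliMeasure Γ κ) ≤ t := by
  classical
  have : Nonempty A := nonempty_of_isProbabilityMeasure κ
  set H := (shannonEntropy κ).toReal
  -- Of the 6θ, two come from the integral of `F`, one from the neighbourhood `O`, one from orbit
  -- errors, and two from `card_le_of_code`.
  obtain ⟨θ, hθ0, hθ1, hθt⟩ : ∃ θ : ℝ, 0 < θ ∧ θ ≤ 1 ∧ H + 6 * θ ≤ t :=
    ⟨min 1 ((t - H) / 6), lt_min one_pos (by linarith), min_le_left _ _, by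
      have := min_le_right 1 ((t - H) / 6); linarith⟩
  refine iSup₂_le fun ε hε ↦ ?_
  obtain ⟨K, ε', hε', hK⟩ := exists_coords_imp_dist_lt d hd (NNReal.coe_pos.2 hε)
  obtain ⟨δ₁, hδ₁, hcoord⟩ := exists_dist_imp_coord_lt d hd 1 (show 0 < ε' / 4 by linarith)
  obtain ⟨N, qz, -, hqz⟩ := exists_measurable_quantizer A (half_pos hε')
  set B := Real.log (Fintype.card (K → Fin (N + 1)) / θ) with hB
  have hB0 : 0 ≤ B := by
    refine Real.log_nonneg ((one_le_div hθ0).2 (hθ1.trans ?_))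
    exact_mod_cast Fintype.card_pos (α := K → Fin (N + 1))
  -- A missing letter at one place pays for its own symbol and for the at most `|K|` places whose
  -- decoding uses it, each at price `B`.
  set M := -Real.log θ + K.card * B with hMdef
  have hlogθ := Real.log_nonpos hθ0.le hθ1
  have hM : 0 ≤ M := by
    have : 0 ≤ K.card * B := by positivity
    linarith
  obtain ⟨T, hTpos, hTc, hTsum⟩ := exists_finset_atoms κ hH (show 0 < θ / (M + 1) by positivity)
  obtain ⟨ℓ, F, hF, hℓ, hFnone, hFsome, hFint⟩ := exists_continuous_cost κ T hθ0 hM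
    (show 0 < ε' / 4 by linarith)
  have hFint' : ∫ a, F a ∂κ ≤ H + 2 * θ := by
    have h1 : M * κ.real (T : Set A)ᶜ ≤ θ := by
      refine (mul_le_mul_of_nonneg_left hTc hM).trans ?_
      rw [← mul_div_assoc, div_le_iff₀ (by positivity)]
      nlinarith
    linarith
  let f : BoundedContinuousFunction (Γ → A) ℝ :=
    BoundedContinuousFunction.mkOfCompact ⟨fun y ↦ F (y 1), hF.comp (continuous_apply 1)⟩
  let O : Set (ProbabilityMeasure (Γ → A)) :=
    {ν | ∫ y, f y ∂(ν : Measure (Γ → A)) < H + 3 * θ}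
  have hO : IsOpen O := isOpen_lt
    (ProbabilityMeasure.continuous_integral_boundedContinuousFunction f) continuous_const
  have hκO : bernoulliMeasure Γ κ ∈ O := by
    have h1 := integral_eval_infinitePi Γ κ hF.measurable 1
    have h2 : ∫ y, f y ∂(bernoulliMeasure Γ κ : Measure (Γ → A)) = ∫ a, F a ∂κ := h1
    change ∫ y, f y ∂(bernoulliMeasure Γ κ : Measure (Γ → A)) < H + 3 * θ
    rw [h2]; linarith
  -- By Markov's inequality, for each `k` the places with error at least `δ₁` have density at most
  -- `δ/δ₁`; over all of `K` they cost at most θ per vertex.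
  set δ := δ₁ * (θ / (K.card * B + 1)) with hδdef
  have hKB : 0 ≤ K.card * B := by positivity
  have hδ : 0 < δ := by positivity
  refine iInf₂_le_of_le δ hδ (iInf_le_of_le (K.image fun k ↦ k⁻¹) (iInf_le_of_le O
    (iInf₂_le_of_le hO hκO (limsup_le_of_le (by isBoundedDefault)
      (Eventually.of_forall fun n ↦ ?_)))))
  have hc := card_V_pos (S := S) n
  have hcard : ∀ C : Finset (S.V n → Γ → A),
      (∀ φ ∈ C, φ ∈ measurePseudoOrbits (shift Γ A) d (S.σ n) δ (K.image fun k ↦ k⁻¹) O) →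
      (∀ φ ∈ C, ∀ ψ ∈ C, φ ≠ ψ → ∃ v, (ε : ℝ) < d.dist (φ v) (ψ v)) →
      (C.card : ℝ) ≤ Real.exp (Fintype.card (S.V n) * t) := by
    intro C hC hsep
    let z : (S.V n → Γ → A) → S.V n → Option T := fun φ v ↦ ℓ (φ v 1)
    let err : (S.V n → Γ → A) → Γ → S.V n → ℝ := fun φ k v ↦
      d.dist (φ (S.σ n k⁻¹ v)) (shift Γ A k⁻¹ (φ v))
    let bad : (S.V n → Γ → A) → Finset (S.V n) := fun φ ↦ Finset.univ.filter fun v ↦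
      ∃ k ∈ K, z φ (S.σ n k⁻¹ v) = none ∨ δ₁ ≤ err φ k v
    let idx : (S.V n → Γ → A) → S.V n → K → Fin (N + 1) := fun φ v k ↦ qz (φ v k)
    refine (card_le_of_code C z bad idx (letterWeight κ T θ) (letterWeight_pos hTpos hθ0) hθ0
      (sum_letterWeight_le κ T θ) (H + 4 * θ) ?_ ?_).trans
        (Real.exp_le_exp.2 (mul_le_mul_of_nonneg_left (by linarith) hc.le))
    · intro φ hφ ψ hψ hz hbad hidx
      by_contra hne
      obtain ⟨v, hv⟩ := hsep φ hφ ψ hψ hne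
      refine absurd hv (not_lt.2 (hK _ _ fun k hk ↦ ?_).le)
      by_cases hvb : v ∈ bad φ
      · have := hqz _ _ (congrFun (hidx v hvb) ⟨k, hk⟩)
        linarith
      · have hvb' : v ∉ bad ψ := hbad ▸ hvb
        simp only [bad, Finset.mem_filter, Finset.mem_univ, true_and, not_exists, not_and,
          not_or, not_le] at hvb hvb'
        have h1 := hcoord _ _ (hvb k hk).2
        have h2 := hcoord _ _ (hvb' k hk).2
        have h3 := hℓ _ _ (congrFun hz (S.σ n k⁻¹ v)) (hvb k hk).1
        have h4 : ∀ φ : S.V n → Γ → A, shift Γ A k⁻¹ (φ v) 1 = φ v k := fun φ ↦ by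
          change φ v (k⁻¹⁻¹ * 1) = _
          rw [inv_inv, mul_one]
        rw [h4] at h1 h2
        have h5 := dist_triangle4 (φ v k) (φ (S.σ n k⁻¹ v) 1) (ψ (S.σ n k⁻¹ v) 1) (ψ v k)
        rw [dist_comm (φ v k) (φ (S.σ n k⁻¹ v) 1)] at h5
        linarith
    · intro φ hφ
      obtain ⟨hφ1, hφ2⟩ := hC φ hφ
      have hO' : ∑ v, F (φ v 1) ≤ Fintype.card (S.V n) * (H + 3 * θ) := by
        have h1 : ∫ y, f y ∂(empiricalDistribution φ : Measure (Γ → A)) < H + 3 * θ := hφ2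
        rw [integral_empiricalDistribution φ f.continuous.stronglyMeasurable,
          inv_mul_lt_iff₀ hc] at h1
        exact h1.le
      set nn := (Finset.univ.filter fun v ↦ z φ v = none).card with hnn
      have herr : ∀ k ∈ K, ((Finset.univ.filter fun v ↦ δ₁ ≤ err φ k v).card : ℝ) ≤
          Fintype.card (S.V n) * (θ / (K.card * B + 1)) := by
        intro k hk
        have h1 := hφ1 k⁻¹ (Finset.mem_image_of_mem _ hk)
        rw [inv_mul_lt_iff₀ hc] at h1
        have h2 := card_filter_mul_le (err φ k) (fun v ↦ @dist_nonneg _ d.toPseudoMetricSpace _ _) δ₁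
        have h3 := h2.trans h1.le
        rw [hδdef, mul_left_comm, mul_comm δ₁] at h3
        exact le_of_mul_le_mul_right h3 hδ₁
      have hbad : ((bad φ).card : ℝ) ≤
          K.card * (nn + Fintype.card (S.V n) * (θ / (K.card * B + 1))) := by
        have h1 : bad φ ⊆ K.biUnion fun k ↦
            (Finset.univ.filter fun v ↦ z φ (S.σ n k⁻¹ v) = none) ∪
              Finset.univ.filter fun v ↦ δ₁ ≤ err φ k v := by
          intro v hv
          obtain ⟨k, hk, h⟩ := (Finset.mem_filter.1 hv).2
          exact Finset.mem_biUnion.2 ⟨k, hk, by simpa using h⟩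
        have h2 : ((bad φ).card : ℝ) ≤ ∑ k ∈ K, (((Finset.univ.filter fun v ↦
            z φ (S.σ n k⁻¹ v) = none).card : ℝ) +
              (Finset.univ.filter fun v ↦ δ₁ ≤ err φ k v).card) := by
          have h3 := (Finset.card_le_card h1).trans Finset.card_biUnion_le
          have h4 := h3.trans (Finset.sum_le_sum fun k _ ↦ Finset.card_union_le _ _)
          exact_mod_cast h4
        refine h2.trans ((Finset.sum_le_sum fun k hk ↦ ?_).trans_eq (by rw [Finset.sum_const,
          nsmul_eq_mul]))
        rw [card_filter_comp_perm (S.σ n k⁻¹) fun v ↦ z φ v = none]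
        exact add_le_add_right (herr k hk) _
      have hcost : ∑ v, -Real.log (letterWeight κ T θ (z φ v)) + nn * (K.card * B) ≤
          ∑ v, F (φ v 1) := by
        have h1 : (nn : ℝ) * (K.card * B) = ∑ v, if z φ v = none then K.card * B else 0 := by
          rw [← Finset.sum_filter, Finset.sum_const, nsmul_eq_mul]
        rw [h1, ← Finset.sum_add_distrib]
        refine Finset.sum_le_sum fun v _ ↦ ?_
        rcases hzv : z φ v with _ | b
        · have := hFnone _ hzv
          simp only [letterWeight, Option.elim, if_true]
          linarith
        · have := hFsome _ b hzv
          simpa [letterWeight] using this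
      have h1 := mul_le_mul_of_nonneg_right hbad hB0
      have h2 : K.card * B * (θ / (K.card * B + 1)) ≤ θ := by
        rw [← mul_div_assoc, div_le_iff₀ (by positivity)]
        nlinarith
      have h3 := mul_le_mul_of_nonneg_left h2 hc.le
      rw [← hB]
      nlinarith
  have hle := sep_le d ε _ hcard
  rw [EReal.div_le_iff_le_mul (by exact_mod_cast hc) (by exact EReal.natCast_ne_top _)]
  calc _ ≤ ENNReal.log (ENNReal.ofReal (Real.exp (Fintype.card (S.V n) * t))) := by
        refine ENNReal.log_monotone ((ENat.toENNReal_le.2 hle).trans ?_)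
        rw [ENat.toENNReal_coe, ← ENNReal.ofReal_natCast]
        exact ENNReal.ofReal_le_ofReal (Nat.floor_le (Real.exp_pos _).le)
    _ = _ := by
        rw [ENNReal.log_ofReal_of_pos (Real.exp_pos _), Real.log_exp]
        push_cast; rfl

theorem measureSoficEntropy_bernoulli {Γ A : Type*} [Group Γ] [Countable Γ] [MetricSpace A]
    [CompactSpace A] [MeasurableSpace A] [BorelSpace A] (S : SoficApproximation Γ)
    (hV : Finite Γ → Tendsto (fun n ↦ Fintype.card (S.V n)) atTop atTop)
    (κ : Measure A) [IsProbabilityMeasure κ] (d : MetricSpace (Γ → A))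
    (hd : d.toUniformSpace.toTopologicalSpace = Pi.topologicalSpace) :
    measureSoficEntropy S (shift Γ A) d (bernoulliMeasure Γ κ) = (shannonEntropy κ : EReal) := by
  have hV' : Tendsto (fun n ↦ Fintype.card (S.V n)) atTop atTop := by
    rcases finite_or_infinite Γ with h | h
    · exact hV h
    · exact tendsto_card_V
  refine le_antisymm ?_ (le_of_forall_lt fun c hc ↦ ?_)
  · by_cases hH : shannonEntropy κ = ⊤
    · rw [hH]; exact le_top
    · refine le_of_forall_gt fun c hc ↦ ?_
      obtain ⟨t, ht, htc⟩ := EReal.lt_iff_exists_real_btwn.1 hc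
      refine (measureSoficEntropy_le S κ d hd hH ?_).trans_lt htc
      rwa [← EReal.coe_lt_coe_iff, EReal.coe_ennreal_toReal hH]
  · obtain ⟨t, hct, ht⟩ := EReal.lt_iff_exists_real_btwn.1 hc
    exact hct.trans_le (le_measureSoficEntropy S κ hV' d hd ht)

/-! ### Conjugate Bernoulli shifts have equal base entropies -/

theorem measurePreserving_shift {Γ A : Type*} [Group Γ] [TopologicalSpace A] [MeasurableSpace A]
    (κ : Measure A) [IsProbabilityMeasure κ] (g : Γ) :
    MeasurePreserving (shift Γ A g) (bernoulliMeasure Γ κ : Measure (Γ → A))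
      (bernoulliMeasure Γ κ : Measure (Γ → A)) :=
  ⟨measurable_pi_lambda _ fun f ↦ measurable_pi_apply (g⁻¹ * f),
    Measure.map_infinitePi_infinitePi_of_inj (P := fun _ : Γ ↦ κ)
      (f := fun f ↦ g⁻¹ * f) (mul_right_injective _)⟩

theorem shift_inv_apply {Γ A : Type*} [Group Γ] [TopologicalSpace A] (g f : Γ) (x : Γ → A) :
    shift Γ A g⁻¹ x f = x (g * f) := by
  change x (g⁻¹⁻¹ * f) = _
  rw [inv_inv]

/-- Equivariance of `ψ` follows by applying `ψ` to the equivariance relation of `φ` at `ψ y`;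
measure preservation carries the null sets along. -/
theorem MeasureConjugate.symm_shift {Γ A B : Type*} [Group Γ] [TopologicalSpace A]
    [MeasurableSpace A] [TopologicalSpace B] [MeasurableSpace B] {κ : Measure A}
    [IsProbabilityMeasure κ] {l : Measure B} [IsProbabilityMeasure l]
    (h : MeasureConjugate (shift Γ A) (bernoulliMeasure Γ κ : Measure (Γ → A))
      (shift Γ B) (bernoulliMeasure Γ l : Measure (Γ → B))) :
    MeasureConjugate (shift Γ B) (bernoulliMeasure Γ l : Measure (Γ → B))
      (shift Γ A) (bernoulliMeasure Γ κ : Measure (Γ → A)) := by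
  obtain ⟨φ, ψ, hφ, hψ, h1, h2, h3⟩ := h
  refine ⟨ψ, φ, hψ, hφ, h2, h1, fun g ↦ ?_⟩
  have h4 := hψ.quasiMeasurePreserving.ae (h3 g)
  have h5 := ((measurePreserving_shift κ g).comp hψ).quasiMeasurePreserving.ae h1
  filter_upwards [h2, h4, h5] with y hy2 hy4 hy5
  rw [hy2] at hy4
  rw [← hy4]
  exact hy5

/-- A finite-alphabet factor of small cost that almost determines the coordinate at the identity up
to the quantizer `qz`. -/
theorem exists_finite_coding {Γ A B : Type*} [Group Γ] [Countable Γ] [TopologicalSpace A]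
    [MeasurableSpace A] [TopologicalSpace B] [MeasurableSpace B] [MeasurableSingletonClass B]
    (κ : Measure A) [IsProbabilityMeasure κ] (l : Measure B) [IsProbabilityMeasure l]
    (h : MeasureConjugate (shift Γ A) (bernoulliMeasure Γ κ : Measure (Γ → A))
      (shift Γ B) (bernoulliMeasure Γ l : Measure (Γ → B)))
    (hl : shannonEntropy l ≠ ⊤) {N : ℕ} {qz : A → Fin (N + 1)} (hqz : Measurable qz)
    {θ D : ℝ} (hθ : 0 < θ) (hθ1 : θ ≤ 1) (hD : 0 ≤ D) :
    ∃ (T : Finset B) (K L J : Finset Γ) (code : (Γ → A) → Option T)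
      (dec : (Γ → Option T) → Fin (N + 1)) (F : (Γ → A) → ℝ) (M : ℝ),
      (∀ b ∈ T, 0 < l.real {b}) ∧ DependsOn code (L : Set Γ) ∧ DependsOn dec (K : Set Γ) ∧
      Measurable F ∧ DependsOn F (J : Set Γ) ∧ (∀ x, |F x| ≤ M) ∧
      ∫ x, F x ∂(bernoulliMeasure Γ κ : Measure (Γ → A)) ≤ (shannonEntropy l).toReal + 3 * θ ∧
      (∀ x, -Real.log (letterWeight l T θ (code x)) ≤ F x) ∧
      ∀ x, qz (x 1) ≠ dec (fun k ↦ code (fun f ↦ x (k * f))) →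
        -Real.log (letterWeight l T θ (code x)) + D ≤ F x := by
  classical
  obtain ⟨φ, ψ, hφ, hψ, hψφ, -, heq⟩ := h
  have hA : Nonempty A := nonempty_of_isProbabilityMeasure κ
  have hB : Nonempty B := nonempty_of_isProbabilityMeasure l
  let b₀ : B := Classical.arbitrary B
  set μ : Measure (Γ → A) := (bernoulliMeasure Γ κ : Measure (Γ → A)) with hμ
  set ν : Measure (Γ → B) := (bernoulliMeasure Γ l : Measure (Γ → B)) with hν
  set H := (shannonEntropy l).toReal
  have hlogθ := Real.log_nonpos hθ.le hθ1
  -- the decoder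
  let f : (Γ → B) → Fin (N + 1) := fun y ↦ qz (ψ y 1)
  have hf : Measurable f := hqz.comp ((measurable_pi_apply 1).comp hψ.measurable)
  obtain ⟨K, f', hf'm, hf'K, hf'⟩ := exists_dependsOn_approx ν f hf
    (show 0 < θ / (D + 1) by positivity)
  -- the alphabet
  have hKD : 0 ≤ K.card * D := by positivity
  -- Each unit of mass outside `T` costs `-log θ` for its letter and `D` for a decoding error at
  -- each of `|K|` places; the tolerance keeps the total below θ.
  obtain ⟨T, hTpos, hTc, hTsum⟩ := exists_finset_atoms l hl
    (show 0 < θ / (-Real.log θ + K.card * D + 1) by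
      apply div_pos hθ; linarith)
  let _ : MeasurableSpace (Option T) := ⊤
  have _ : DiscreteMeasurableSpace (Option T) := ⟨fun _ ↦ trivial⟩
  let letter : B → Option T := fun b ↦ if h : b ∈ T then some ⟨b, h⟩ else none
  have hletter : Measurable letter := by
    refine measurable_to_countable' fun q ↦ ?_
    rcases q with _ | b
    · convert T.measurableSet.compl using 1
      ext b
      by_cases hb : b ∈ T <;> simp [letter, hb]
    · convert measurableSet_singleton (b : B) using 1
      ext b'
      by_cases hb : b' ∈ T
      · simp [letter, hb, Subtype.ext_iff]
      · simp only [letter, hb, dif_neg, not_false_eq_true, Set.mem_preimage,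
          Set.mem_singleton_iff, reduceCtorEq, false_iff]
        exact fun h ↦ hb (h ▸ b.2)
  set w := letterWeight l T θ with hw
  let c : Option T → ℝ := fun q ↦ -Real.log (w q)
  set M₀ := ∑ q, |c q|
  have hM₀ : ∀ q, |c q| ≤ M₀ := fun q ↦
    Finset.single_le_sum (f := fun q ↦ |c q|) (fun q _ ↦ abs_nonneg _) (Finset.mem_univ q)
  have hM₀0 : 0 ≤ M₀ := Finset.sum_nonneg fun q _ ↦ abs_nonneg _
  -- the coding map
  let g : (Γ → A) → Option T := fun x ↦ letter (φ x 1)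
  have hg : Measurable g := hletter.comp ((measurable_pi_apply 1).comp hφ.measurable)
  -- Replacing `g` by `code` changes the letter cost by at most `2 * M₀` on the set where they
  -- differ, and that set enters the error event through `|K|` translates.
  obtain ⟨L, code, hcode, hcodeL, hcodeg⟩ := exists_dependsOn_approx μ g hg
    (show 0 < θ / (2 * M₀ + K.card * D + 1) by positivity)
  let point : Option T → B := fun q ↦ q.elim b₀ fun b ↦ b
  let dec : (Γ → Option T) → Fin (N + 1) := fun q ↦ f' fun k ↦ point (q k)
  have hdecK : DependsOn dec (K : Set Γ) := fun q q' hqq ↦ hf'K fun k hk ↦ by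
    simp only [hqq k hk]
  have hdec : Measurable fun x : Γ → A ↦ dec fun k ↦ code fun i ↦ x (k * i) := by
    refine hf'm.comp (measurable_pi_lambda _ fun k ↦ ?_)
    refine (Measurable.of_discrete (f := point)).comp (hcode.comp ?_)
    exact measurable_pi_lambda _ fun i ↦ measurable_pi_apply _
  let E : Set (Γ → A) := {x | qz (x 1) ≠ dec fun k ↦ code fun i ↦ x (k * i)}
  have hE : MeasurableSet E :=
    (measurableSet_eq_fun (hqz.comp (measurable_pi_apply 1)) hdec).compl
  let F : (Γ → A) → ℝ := fun x ↦ c (code x) + E.indicator (fun _ ↦ D) x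
  have hc : Measurable fun x ↦ c (code x) := (Measurable.of_discrete (f := c)).comp hcode
  have hFm : Measurable F := hc.add (measurable_const.indicator hE)
  -- The true colour is read at 1, the letter on `L`, and the decoder, which reads letters at `K`,
  -- uses coordinates in `K·L`.
  let J : Finset Γ := insert 1 (L ∪ (K ×ˢ L).image fun p ↦ p.1 * p.2)
  have hEJ : ∀ x y : Γ → A, (∀ i ∈ (J : Set Γ), x i = y i) → (x ∈ E ↔ y ∈ E) := by
    intro x y hxy
    have h1 : x 1 = y 1 := hxy 1 (by simp [J])
    have h2 : dec (fun k ↦ code fun i ↦ x (k * i)) = dec fun k ↦ code fun i ↦ y (k * i) := by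
      refine hdecK fun k hk ↦ hcodeL fun i hi ↦ hxy _ ?_
      simp only [J, Finset.coe_insert, Finset.coe_union, Finset.coe_image]
      exact Or.inr (Or.inr ⟨(k, i), by simpa using ⟨hk, hi⟩, rfl⟩)
    change (_ ≠ _) ↔ (_ ≠ _)
    rw [h1, h2]
  have hFJ : DependsOn F (J : Set Γ) := by
    intro x y hxy
    have h1 : code x = code y := hcodeL fun i hi ↦ hxy i (by
      simp only [J, Finset.coe_insert, Finset.coe_union]
      exact Or.inr (Or.inl hi))
    have h2 := hEJ x y hxy
    simp only [F, h1, Set.indicator_apply, h2]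
  have hFM : ∀ x, |F x| ≤ M₀ + D := fun x ↦ by
    refine (abs_add_le _ _).trans (add_le_add (hM₀ _) ?_)
    by_cases hx : x ∈ E
    · rw [Set.indicator_of_mem hx, abs_of_nonneg hD]
    · rw [Set.indicator_of_notMem hx]; simpa
  -- the probability of a decoding error
  have hEμ : μ.real E ≤ θ / (D + 1) + K.card * (l.real (T : Set B)ᶜ +
      θ / (2 * M₀ + K.card * D + 1)) := by
    -- Decoding fails only if the local decoder is wrong at `φ x`, or for some `k ∈ K` the
    -- coordinate `φ x k` leaves the alphabet or the local code is wrong at the translate by `k⁻¹`.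
    have hae : ∀ᵐ x ∂μ, x ∈ E → x ∈ {x | f (φ x) ≠ f' (φ x)} ∪
        ⋃ k ∈ K, ({x | φ x k ∈ (T : Set B)ᶜ} ∪
          shift Γ A k⁻¹ ⁻¹' {x | g x ≠ code x}) := by
      have h1 : ∀ᵐ x ∂μ, ∀ k : Γ, φ (shift Γ A k⁻¹ x) = shift Γ B k⁻¹ (φ x) :=
        ae_all_iff.2 fun k ↦ heq k⁻¹
      filter_upwards [hψφ, h1] with x hx1 hx2 hxE
      by_contra hcon
      simp only [Set.mem_union, Set.mem_iUnion, not_or, not_exists] at hcon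
      obtain ⟨hc1, hc2⟩ := hcon
      simp only [Set.mem_ofPred_eq, not_not] at hc1
      apply hxE
      have h2 : qz (x 1) = f' (φ x) := by
        rw [← hc1]; simp only [f, hx1]
      rw [h2]
      refine hf'K fun k hk ↦ ?_
      obtain ⟨h3, h4⟩ := hc2 k hk
      have h3 : φ x k ∈ T := by simpa using h3
      simp only [Set.mem_preimage, Set.mem_ofPred_eq, not_not] at h4
      have h5 : code (fun i ↦ x (k * i)) = letter (φ x k) := by
        have h6 : (fun i ↦ x (k * i)) = shift Γ A k⁻¹ x := by
          funext i; rw [shift_inv_apply]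
        rw [h6, ← h4]
        simp only [g, hx2, shift_inv_apply, mul_one]
      simp [h5, letter, h3, point]
    have h1 : μ.real E ≤ μ.real ({x | f (φ x) ≠ f' (φ x)} ∪
        ⋃ k ∈ K, ({x | φ x k ∈ (T : Set B)ᶜ} ∪ shift Γ A k⁻¹ ⁻¹' {x | g x ≠ code x})) :=
      ENNReal.toReal_mono (measure_ne_top _ _) (measure_mono_ae hae)
    have h2 : μ.real {x | f (φ x) ≠ f' (φ x)} = ν.real {y | f y ≠ f' y} := by
      have hm : MeasurableSet {y | f y ≠ f' y} := (measurableSet_eq_fun hf hf'm).compl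
      rw [measureReal_def, measureReal_def, ← hφ.measure_preimage hm.nullMeasurableSet]
      rfl
    have h3 : ∀ k, μ.real {x | φ x k ∈ (T : Set B)ᶜ} = l.real (T : Set B)ᶜ := by
      intro k
      have hp := (measurePreserving_eval_infinitePi (fun _ : Γ ↦ l) k).comp hφ
      rw [measureReal_def, measureReal_def,
        ← hp.measure_preimage T.measurableSet.compl.nullMeasurableSet]
      rfl
    have h4 : ∀ k, μ.real (shift Γ A k⁻¹ ⁻¹' {x | g x ≠ code x}) = μ.real {x | g x ≠ code x} := by
      intro k
      have hm : MeasurableSet {x | g x ≠ code x} := (measurableSet_eq_fun hg hcode).compl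
      rw [measureReal_def, measureReal_def,
        (measurePreserving_shift κ k⁻¹).measure_preimage hm.nullMeasurableSet]
    calc μ.real E ≤ _ := h1
      _ ≤ μ.real {x | f (φ x) ≠ f' (φ x)} + ∑ k ∈ K, (μ.real {x | φ x k ∈ (T : Set B)ᶜ} +
          μ.real (shift Γ A k⁻¹ ⁻¹' {x | g x ≠ code x})) := by
        refine (measureReal_union_le _ _).trans (add_le_add_right ?_ _)
        refine (measureReal_biUnion_finset_le _ _).trans (Finset.sum_le_sum fun k _ ↦ ?_)
        exact measureReal_union_le _ _
      _ = ν.real {y | f y ≠ f' y} + K.card * (l.real (T : Set B)ᶜ + μ.real {x | g x ≠ code x}) := by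
        simp_rw [h2, h3, h4]
        rw [Finset.sum_const, nsmul_eq_mul]
      _ ≤ _ := by gcongr
  -- the expected cost
  have hcletter : ∫ b, c (letter b) ∂l = ∑ b ∈ T, l.real {b} * -Real.log (l.real {b}) +
      l.real (T : Set B)ᶜ * -Real.log θ := by
    have hm : Measurable fun b ↦ c (letter b) := (Measurable.of_discrete (f := c)).comp hletter
    have hi : Integrable (fun b ↦ c (letter b)) l :=
      Integrable.of_bound hm.aestronglyMeasurable M₀ (ae_of_all _ fun b ↦ hM₀ _)
    rw [← integral_add_compl T.measurableSet hi, setIntegral_finset T hi.integrableOn]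
    congr 1
    · refine Finset.sum_congr rfl fun b hb ↦ ?_
      simp [letter, hb, c, hw, letterWeight]
    · rw [setIntegral_congr_fun (g := fun _ ↦ -Real.log θ) T.measurableSet.compl]
      · simp
      · intro b hb
        have hb' : b ∉ T := hb
        simp [letter, hb', c, hw, letterWeight]
  have hgint : ∫ x, c (g x) ∂μ = ∫ b, c (letter b) ∂l := by
    have hm : Measurable fun b ↦ c (letter b) := (Measurable.of_discrete (f := c)).comp hletter
    have hp := (measurePreserving_eval_infinitePi (fun _ : Γ ↦ l) 1).comp hφ
    have h1 := integral_map hp.aemeasurable hm.aestronglyMeasurable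
    rw [hp.map_eq] at h1
    exact h1.symm
  have hbad : MeasurableSet {x | g x ≠ code x} := (measurableSet_eq_fun hg hcode).compl
  have hcint : ∫ x, c (code x) ∂μ ≤ ∫ x, c (g x) ∂μ + 2 * M₀ * μ.real {x | g x ≠ code x} := by
    have hi1 : Integrable (fun x ↦ c (code x)) μ :=
      Integrable.of_bound hc.aestronglyMeasurable M₀ (ae_of_all _ fun b ↦ hM₀ _)
    have hi2 : Integrable (fun x ↦ c (g x)) μ :=
      Integrable.of_bound ((Measurable.of_discrete (f := c)).comp hg).aestronglyMeasurable M₀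
        (ae_of_all _ fun b ↦ hM₀ _)
    have hi3 : Integrable ({x | g x ≠ code x}.indicator fun _ ↦ 2 * M₀) μ :=
      (integrable_const _).indicator hbad
    have h1 : ∫ x, {x | g x ≠ code x}.indicator (fun _ ↦ 2 * M₀) x ∂μ =
        2 * M₀ * μ.real {x | g x ≠ code x} := by
      rw [integral_indicator_const _ hbad, smul_eq_mul, mul_comm]
    rw [← h1, ← integral_add hi2 hi3]
    refine integral_mono hi1 (hi2.add hi3) fun x ↦ ?_
    by_cases hx : g x = code x
    · simp [hx]
    · have : x ∈ {x | g x ≠ code x} := hx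
      simp only [Set.indicator_of_mem this]
      have h2 := (abs_le.1 (hM₀ (code x))).2
      have h3 := (abs_le.1 (hM₀ (g x))).1
      linarith
  have hFint : ∫ x, F x ∂μ = ∫ x, c (code x) ∂μ + D * μ.real E := by
    have hi1 : Integrable (fun x ↦ c (code x)) μ :=
      Integrable.of_bound hc.aestronglyMeasurable M₀ (ae_of_all _ fun b ↦ hM₀ _)
    simp only [F]
    rw [integral_add hi1 ((integrable_const _).indicator hE), integral_indicator_const _ hE,
      smul_eq_mul, mul_comm D]
  refine ⟨T, K, L, J, code, dec, F, M₀ + D, hTpos, hcodeL, hdecK, hFm, hFJ, hFM, ?_, ?_, ?_⟩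
  · rw [hFint]
    have h1 := mul_le_mul_of_nonneg_left hEμ hD
    have h2 : D * (θ / (D + 1)) ≤ θ := by
      rw [← mul_div_assoc, div_le_iff₀ (by positivity)]
      nlinarith
    have h3 : (-Real.log θ + K.card * D) * l.real (T : Set B)ᶜ ≤ θ := by
      refine (mul_le_mul_of_nonneg_left hTc (by linarith)).trans ?_
      rw [← mul_div_assoc, div_le_iff₀ (by linarith)]
      nlinarith
    have h4 : (2 * M₀ + K.card * D) * (θ / (2 * M₀ + K.card * D + 1)) ≤ θ := by
      rw [← mul_div_assoc, div_le_iff₀ (by positivity)]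
      nlinarith
    have h5 := mul_le_mul_of_nonneg_left hcodeg (show 0 ≤ 2 * M₀ by positivity)
    rw [hgint, hcletter] at hcint
    linarith
  · intro x
    have : 0 ≤ E.indicator (fun _ ↦ D) x := Set.indicator_nonneg (fun _ _ ↦ hD) x
    simp only [F, c]
    linarith
  · intro x hx
    have hxE : x ∈ E := hx
    simp only [F, c, Set.indicator_of_mem hxE]
    exact le_rfl

/-- If `H(κ)` were larger, there would be `exp(t|V_n|)` separated κ-colourings with `t > H(l)`.
Their local codes are words over the atoms of `l`, from which the colouring is recovered up to ε
except at rare places, and `card_le_of_code` allows too few of them. -/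
theorem shannonEntropy_le_of_measureConjugate {Γ A B : Type*} [Group Γ] [Countable Γ]
    (S : SoficApproximation Γ) (hV : Tendsto (fun n ↦ Fintype.card (S.V n)) atTop atTop)
    [MetricSpace A] [CompactSpace A] [MeasurableSpace A] [BorelSpace A]
    [TopologicalSpace B] [MeasurableSpace B] [MeasurableSingletonClass B]
    (κ : Measure A) [IsProbabilityMeasure κ] (l : Measure B) [IsProbabilityMeasure l]
    (h : MeasureConjugate (shift Γ A) (bernoulliMeasure Γ κ : Measure (Γ → A))
      (shift Γ B) (bernoulliMeasure Γ l : Measure (Γ → B))) :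
    shannonEntropy κ ≤ shannonEntropy l := by
  classical
  by_contra! hlt
  have hA : Nonempty A := nonempty_of_isProbabilityMeasure κ
  have hl : shannonEntropy l ≠ ⊤ := hlt.ne_top
  obtain ⟨t, ht1, ht2⟩ := EReal.lt_iff_exists_real_btwn.1 (EReal.coe_ennreal_lt_coe_ennreal_iff.2 hlt)
  rw [← EReal.coe_ennreal_toReal hl, EReal.coe_lt_coe_iff] at ht1
  set H := (shannonEntropy l).toReal with hH
  -- The 7θ are three from the coding, one from the law of large numbers, one from failures of
  -- multiplicativity, and two from `card_le_of_code`.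
  obtain ⟨θ, hθ0, hθ1, hθt⟩ : ∃ θ : ℝ, 0 < θ ∧ θ ≤ 1 ∧ H + 7 * θ < t :=
    ⟨min 1 ((t - H) / 8), lt_min one_pos (by linarith), min_le_left _ _, by
      have := min_le_right 1 ((t - H) / 8); linarith⟩
  obtain ⟨ε, hε, hsep⟩ := eventually_exists_separated S hV κ ht2
  obtain ⟨N, qz, hqzm, hqz⟩ := exists_measurable_quantizer A hε
  set D := Real.log (Fintype.card (Fin (N + 1)) / θ) with hD
  have hD0 : 0 ≤ D := by
    refine Real.log_nonneg ((one_le_div hθ0).2 (hθ1.trans ?_))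
    exact_mod_cast Fintype.card_pos (α := Fin (N + 1))
  obtain ⟨T, K, L, J, code, dec, F, M, hTpos, hcodeL, hdecK, hFm, hFJ, hFM, hFint, hF1, hF2⟩ :=
    exists_finite_coding κ l h hl hqzm hθ0 hθ1 hD0
  have hav := improbable_average (S := S) (κ := κ) hV hFm hFJ hFM hθ0
  -- Outside these vertices the local letters of the pullback at `v` are the letters recorded at the
  -- vertices `σ(k⁻¹)v`, so the decoder needs only the word.
  let nm : ∀ n, S.V n → Prop := fun n v ↦
    ∃ p ∈ K ×ˢ L, S.σ n (p.2⁻¹ * p.1⁻¹) v ≠ S.σ n p.2⁻¹ (S.σ n p.1⁻¹ v)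
  have hnm : Negligible S nm := Negligible.exists_finset (K ×ˢ L)
    (p := fun p n v ↦ S.σ n (p.2⁻¹ * p.1⁻¹) v ≠ S.σ n p.2⁻¹ (S.σ n p.1⁻¹ v))
    fun p _ ↦ negligible_not_mul p.2⁻¹ p.1⁻¹
  have hnm' := Tendsto.const_mul D hnm
  rw [mul_zero] at hnm'
  obtain ⟨n, ⟨C, hC1, hC2, hC3⟩, hn⟩ := ((hsep (fun n x ↦
    ∑ v, F (pullback S x v) ≤ Fintype.card (S.V n) * (H + 4 * θ)) (hav.mono fun n x hx ↦ by
      by_contra! hcon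
      apply hx
      have h1 := (abs_lt.1 hcon).2
      have h2 : ∫ y, F y ∂(Measure.infinitePi fun _ : Γ ↦ κ) ≤ H + 3 * θ := hFint
      have h3 : (Fintype.card (S.V n) : ℝ)⁻¹ * ∑ v, F (pullback S x v) < H + 4 * θ := by linarith
      rw [inv_mul_lt_iff₀ (card_V_pos n)] at h3
      exact h3.le)).and (hnm'.eventually (gt_mem_nhds hθ0))).exists
  have hc := card_V_pos (S := S) n
  have hdec : ∀ (x : S.V n → A) v, ¬ nm n v →
      dec (fun k ↦ code fun f ↦ pullback S x v (k * f)) =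
        dec fun k ↦ code (pullback S x (S.σ n k⁻¹ v)) := by
    intro x v hv
    refine hdecK fun k hk ↦ hcodeL fun f hf ↦ ?_
    have h1 : S.σ n (f⁻¹ * k⁻¹) v = S.σ n f⁻¹ (S.σ n k⁻¹ v) := by
      by_contra h2
      exact hv ⟨(k, f), Finset.mem_product.2 ⟨hk, hf⟩, h2⟩
    simp only [pullback, mul_inv_rev, h1]
  let bad : (S.V n → A) → Finset (S.V n) := fun x ↦ Finset.univ.filter fun v ↦
    qz (pullback S x v 1) ≠ dec (fun k ↦ code fun f ↦ pullback S x v (k * f)) ∨ nm n v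
  have hcard := card_le_of_code C (fun x v ↦ code (pullback S x v)) bad
    (fun x v ↦ qz (pullback S x v 1)) (letterWeight l T θ) (letterWeight_pos hTpos hθ0) hθ0
    (sum_letterWeight_le l T θ) (H + 5 * θ) (by
      intro x hx y hy hz hbad hidx
      by_contra hne
      obtain ⟨v, hv⟩ := hC2 x hx y hy hne
      refine absurd hv (not_lt.2 ?_)
      obtain ⟨u, rfl⟩ := (S.σ n 1⁻¹).surjective v
      refine hqz _ _ ?_
      by_cases hu : u ∈ bad x
      · exact hidx u hu
      · have hu' : u ∉ bad y := hbad ▸ hu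
        simp only [bad, Finset.mem_filter, Finset.mem_univ, true_and, not_or, not_not] at hu hu'
        have h1 := hu.1
        have h2 := hu'.1
        rw [hdec x u hu.2] at h1
        rw [hdec y u hu.2] at h2
        have h3 : ∀ k, code (pullback S x (S.σ n k⁻¹ u)) = code (pullback S y (S.σ n k⁻¹ u)) :=
          fun k ↦ congrFun hz (S.σ n k⁻¹ u)
        simp only [h3] at h1
        exact h1.trans h2.symm) (by
      intro x hx
      have h1 : ((bad x).card : ℝ) ≤ ((Finset.univ.filter fun v ↦ qz (pullback S x v 1) ≠
          dec (fun k ↦ code fun f ↦ pullback S x v (k * f))).card : ℝ) +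
            Set.ncard {v | nm n v} := by
        have h2 : Set.ncard {v | nm n v} = (Finset.univ.filter (nm n)).card := by
          rw [← Set.ncard_coe_finset]; simp
        rw [h2]
        simp only [bad, Finset.filter_or]
        exact_mod_cast Finset.card_union_le _ _
      have h2 : ∑ v, -Real.log (letterWeight l T θ (code (pullback S x v))) +
          ((Finset.univ.filter fun v ↦ qz (pullback S x v 1) ≠
            dec (fun k ↦ code fun f ↦ pullback S x v (k * f))).card : ℝ) * D ≤
          ∑ v, F (pullback S x v) := by
        rw [← nsmul_eq_mul, ← Finset.sum_const, Finset.sum_filter, ← Finset.sum_add_distrib]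
        refine Finset.sum_le_sum fun v _ ↦ ?_
        split_ifs with h3
        · exact hF2 _ h3
        · rw [add_zero]; exact hF1 _
      have h3 := hC1 x hx
      have h4 : Set.ncard {v | nm n v} * D ≤ Fintype.card (S.V n) * θ := by
        have h5 : D * Set.ncard {v | nm n v} / Fintype.card (S.V n) < θ := by
          rw [mul_div_assoc]; exact hn
        rw [div_lt_iff₀ hc] at h5
        linarith
      have h5 := mul_le_mul_of_nonneg_right h1 hD0
      rw [← hD]
      linarith)
  have h1 := Real.exp_le_exp.1 (hC3.trans hcard)
  nlinarith

theorem not_measureConjugate_of_shannonEntropy_ne {Γ A B : Type*} [Group Γ] [Countable Γ]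
    (hΓ : IsSofic Γ) [MetricSpace A] [CompactSpace A] [MeasurableSpace A] [BorelSpace A]
    [MetricSpace B] [CompactSpace B] [MeasurableSpace B] [BorelSpace B]
    (κ : Measure A) [IsProbabilityMeasure κ] (l : Measure B) [IsProbabilityMeasure l]
    (hne : shannonEntropy κ ≠ shannonEntropy l) :
    ¬ MeasureConjugate (shift Γ A) (bernoulliMeasure Γ κ : Measure (Γ → A))
      (shift Γ B) (bernoulliMeasure Γ l : Measure (Γ → B)) := by
  intro h
  obtain ⟨S⟩ := hΓ
  have hV := tendsto_card_copies S
  exact hne (le_antisymm (shannonEntropy_le_of_measureConjugate S.copies hV κ l h)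
    (shannonEntropy_le_of_measureConjugate S.copies hV l κ h.symm_shift))

/-! ### Free groups are sofic -/

/-- Left multiplication of a group on itself is exactly multiplicative, and a nontrivial element has
no fixed point. -/
theorem isSofic_of_monoidHom {Γ : Type*} [Group Γ] (G : ℕ → Type) [∀ n, Group (G n)]
    [∀ n, Finite (G n)] (ρ : ∀ n, Γ →* G n) (hρ : ∀ g, g ≠ 1 → ∀ᶠ n in atTop, ρ n g ≠ 1) :
    IsSofic Γ := by
  have _ : ∀ n, Fintype (G n) := fun n ↦ Fintype.ofFinite (G n)
  refine ⟨{ V := G, σ := fun n g ↦ Equiv.mulLeft (ρ n g), asymptotically_multiplicative := ?_,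
            asymptotically_free := ?_ }⟩
  · intro g h
    refine tendsto_const_nhds.congr fun n ↦ ?_
    have h1 : {v : G n | Equiv.mulLeft (ρ n (g * h)) v =
        Equiv.mulLeft (ρ n g) (Equiv.mulLeft (ρ n h) v)} = Set.univ := by
      ext v; simp
    have h2 : (0 : ℝ) < Fintype.card (G n) := by exact_mod_cast Fintype.card_pos
    rw [h1, Set.ncard_univ, Nat.card_eq_fintype_card, div_self h2.ne']
  · intro g hg
    refine tendsto_const_nhds.congr' ?_
    filter_upwards [hρ g hg] with n hn
    have h1 : {v : G n | Equiv.mulLeft (ρ n g) v = v} = ∅ := by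
      ext v; simpa using hn
    rw [h1]
    simp

section FreeGroup

variable {α : Type} [Finite α] [DecidableEq α]

/-- The ball of radius `n` around the identity of a free group. -/
abbrev FreeBall (α : Type) [DecidableEq α] (n : ℕ) : Type := {w : FreeGroup α // w.norm ≤ n}

instance (n : ℕ) : Finite (FreeBall α n) := by
  have h := List.finite_length_le (α × Bool) n
  have : Finite {l : List (α × Bool) | l.length ≤ n} := h
  refine Finite.of_injective (β := {l : List (α × Bool) | l.length ≤ n})
    (fun w ↦ ⟨w.1.toWord, w.2⟩) fun w w' hww ↦ ?_
  exact Subtype.ext (FreeGroup.toWord_injective (congrArg Subtype.val hww))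

/-- Left multiplication by a generator is a partial injection of the finite ball, and a partial
injection of a finite set extends to a permutation. -/
theorem exists_perm_freeBall (n : ℕ) (a : α) : ∃ e : Equiv.Perm (FreeBall α n),
    ∀ (w : FreeBall α n) (h : (FreeGroup.of a * w.1).norm ≤ n), e w = ⟨FreeGroup.of a * w.1, h⟩ := by
  classical
  have := Fintype.ofFinite (FreeBall α n)
  let e₀ : {w : FreeBall α n // (FreeGroup.of a * w.1).norm ≤ n} ≃
      {w : FreeBall α n // ((FreeGroup.of a)⁻¹ * w.1).norm ≤ n} :=
    { toFun := fun w ↦ ⟨⟨FreeGroup.of a * w.1.1, w.2⟩, by simpa using w.1.2⟩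
      invFun := fun w ↦ ⟨⟨(FreeGroup.of a)⁻¹ * w.1.1, w.2⟩, by simpa using w.1.2⟩
      left_inv := fun w ↦ by simp
      right_inv := fun w ↦ by simp }
  exact ⟨e₀.extendSubtype, fun w h ↦ by
    rw [Equiv.extendSubtype_apply_of_mem e₀ w h]; rfl⟩

/-- Freeness extends any choice of permutations to a homomorphism. Applying the letters of a word of
length at most `n` to the identity never leaves the ball, so a reduced word moves the identity to
itself as a group element, and nontrivial elements act nontrivially. -/
theorem exists_monoidHom_freeBall (n : ℕ) : ∃ ρ : FreeGroup α →* Equiv.Perm (FreeBall α n),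
    ∀ w : FreeGroup α, w ≠ 1 → w.norm ≤ n → ρ w ≠ 1 := by
  choose e he using exists_perm_freeBall (α := α) n
  let o : FreeBall α n := ⟨1, by simp⟩
  have key : ∀ L : List (α × Bool), L.length ≤ n →
      (FreeGroup.lift e (FreeGroup.mk L) o).1 = FreeGroup.mk L := by
    intro L
    induction L with
    | nil => intro _; rw [← FreeGroup.one_eq_mk, map_one, Equiv.Perm.one_apply]
    | cons p L ih =>
      intro hL
      obtain ⟨a, b⟩ := p
      have hL' : L.length ≤ n := (Nat.le_succ _).trans hL
      have hmul : FreeGroup.mk ((a, b) :: L) = FreeGroup.mk [(a, b)] * FreeGroup.mk L := by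
        rw [FreeGroup.mul_mk]; rfl
      have hn : (FreeGroup.mk ((a, b) :: L)).norm ≤ n := FreeGroup.norm_mk_le.trans hL
      have hn' : (FreeGroup.mk L).norm ≤ n := FreeGroup.norm_mk_le.trans hL'
      have ih' : FreeGroup.lift e (FreeGroup.mk L) o = ⟨FreeGroup.mk L, hn'⟩ :=
        Subtype.ext (ih hL')
      rw [hmul] at hn ⊢
      rw [map_mul, Equiv.Perm.mul_apply, ih']
      cases b with
      | true =>
        have h2 : FreeGroup.mk [(a, true)] = FreeGroup.of a := rfl
        rw [h2] at hn ⊢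
        rw [FreeGroup.lift_apply_of, he a _ hn]
      | false =>
        have h2 : FreeGroup.mk [(a, false)] = (FreeGroup.of a)⁻¹ := rfl
        rw [h2] at hn ⊢
        -- The permutation of `a` is known only where multiplication stays in the ball; here it
        -- sends `a⁻¹u` to `u`, which determines its inverse at `u`.
        have h3 := he a ⟨_, hn⟩ (by rwa [mul_inv_cancel_left])
        simp only [mul_inv_cancel_left] at h3
        rw [map_inv, FreeGroup.lift_apply_of, ← h3, ← Equiv.Perm.mul_apply, inv_mul_cancel,
          Equiv.Perm.one_apply]
  refine ⟨FreeGroup.lift e, fun w hw hn h ↦ hw ?_⟩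
  have h1 := key w.toWord hn
  rw [FreeGroup.mk_toWord, h] at h1
  exact h1.symm

theorem isSofic_freeGroup : IsSofic (FreeGroup α) := by
  choose ρ hρ using exists_monoidHom_freeBall (α := α)
  refine isSofic_of_monoidHom _ ρ fun w hw ↦ ?_
  filter_upwards [eventually_ge_atTop w.norm] with n hn using hρ n w hw hn

end FreeGroup

/-! ### Haar measures -/

section Haar

variable {A : Type*} [AddCommGroup A] [TopologicalSpace A] [IsTopologicalAddGroup A]
  [CompactSpace A] [SecondCountableTopology A] [MeasurableSpace A] [BorelSpace A]

instance : IsProbabilityMeasure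
    (Measure.addHaarMeasure (⊤ : TopologicalSpace.PositiveCompacts A)) :=
  ⟨Measure.addHaarMeasure_self⟩

/-- The product measure is translation invariant, each factor being so, and has total mass one;
uniqueness of Haar measure does the rest. -/
theorem addHaarMeasure_pi_eq_bernoulliMeasure (Γ : Type*) [Countable Γ] :
    Measure.addHaarMeasure (⊤ : TopologicalSpace.PositiveCompacts (Γ → A)) =
      (bernoulliMeasure Γ (Measure.addHaarMeasure (⊤ : TopologicalSpace.PositiveCompacts A)) :
        Measure (Γ → A)) := by
  set κ := Measure.addHaarMeasure (⊤ : TopologicalSpace.PositiveCompacts A)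
  have hinv : (bernoulliMeasure Γ κ : Measure (Γ → A)).IsAddLeftInvariant := by
    refine ⟨fun y ↦ ?_⟩
    have h1 := Measure.infinitePi_map_pi (fun _ : Γ ↦ κ) (f := fun i a ↦ y i + a)
      (fun i ↦ measurable_const_add (y i))
    simp only [map_add_left_eq_self] at h1
    exact h1
  refine (Measure.addHaarMeasure_eq_iff _ _).2 ?_
  exact measure_univ

theorem shannonEntropy_addHaarMeasure [Fintype A] [MeasurableSingletonClass A] :
    shannonEntropy (Measure.addHaarMeasure (⊤ : TopologicalSpace.PositiveCompacts A)) =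
      ENNReal.ofReal (Real.log (Fintype.card A)) := by
  set κ := Measure.addHaarMeasure (⊤ : TopologicalSpace.PositiveCompacts A)
  have hc : (0 : ℝ) < Fintype.card A := by exact_mod_cast Fintype.card_pos
  have h0 : ∀ a, κ.real {a} = κ.real {0} := fun a ↦ by
    have h1 := measure_preimage_add κ (-a) {0}
    rw [measureReal_def, measureReal_def, ← h1]
    congr 2
    ext b
    simp [eq_comm]
  have h1 : ∀ a, κ.real {a} = (Fintype.card A : ℝ)⁻¹ := fun a ↦ by
    have h2 : ∑ b, κ.real {b} = 1 := by
      rw [sum_measureReal_singleton, Finset.coe_univ, probReal_univ]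
    simp_rw [h0, Finset.sum_const, nsmul_eq_mul] at h2
    rw [h0]
    exact eq_inv_of_mul_eq_one_right h2
  rw [shannonEntropy, if_pos ⟨Set.univ, Set.countable_univ, by simp⟩, tsum_fintype]
  simp_rw [h1]
  rw [Finset.sum_const, Finset.card_univ, nsmul_eq_mul, ← ENNReal.ofReal_natCast, ← ENNReal.ofReal_mul hc.le]
  congr 1
  rw [Real.log_inv]
  field_simp

end Haar

theorem not_measureConjugate_freeGroup :
    ¬ MeasureConjugate
      (shift (FreeGroup (Fin 2)) (ZMod 2))
      (Measure.addHaarMeasure (⊤ : TopologicalSpace.PositiveCompacts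
        (FreeGroup (Fin 2) → ZMod 2)))
      (shift (FreeGroup (Fin 2)) (ZMod 2 × ZMod 2))
      (Measure.addHaarMeasure (⊤ : TopologicalSpace.PositiveCompacts
        (FreeGroup (Fin 2) → ZMod 2 × ZMod 2))) := by
  let _ : MetricSpace (ZMod 2) := TopologicalSpace.metrizableSpaceMetric (ZMod 2)
  have hcount : Countable (FreeGroup (Fin 2)) := FreeGroup.toWord_injective.countable
  rw [addHaarMeasure_pi_eq_bernoulliMeasure, addHaarMeasure_pi_eq_bernoulliMeasure]
  refine not_measureConjugate_of_shannonEntropy_ne isSofic_freeGroup _ _ ?_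
  rw [shannonEntropy_addHaarMeasure, shannonEntropy_addHaarMeasure]
  intro h
  have h2 := (ENNReal.ofReal_eq_ofReal_iff (Real.log_natCast_nonneg _)
    (Real.log_natCast_nonneg _)).1 h
  have h3 : Real.log 2 < Real.log 4 := Real.log_lt_log two_pos (by norm_num)
  simp only [Fintype.card_prod, ZMod.card] at h2
  norm_num at h2
  linarith

end SoficEntropy

open SoficEntropy in
theorem mainTheorem1 :
    -- The entropy formula, for every metric `d` that induces the product topology of `A^Γ`.
    (∀ (Γ : Type*) [Group Γ] [Countable Γ] (S : SoficApproximation Γ)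
      (_ : Finite Γ → Tendsto (fun n ↦ Fintype.card (S.V n)) atTop atTop)
      (A : Type*) [MetricSpace A] [CompactSpace A] [MeasurableSpace A] [BorelSpace A]
      (κ : Measure A) [IsProbabilityMeasure κ]
      (d : MetricSpace (Γ → A))
      (_ : d.toUniformSpace.toTopologicalSpace = Pi.topologicalSpace),
      measureSoficEntropy S (shift Γ A) d (bernoulliMeasure Γ κ) = (shannonEntropy κ : EReal)) ∧
    -- Bernoulli shifts over a sofic group with different base entropies are not conjugate.
    (∀ (Γ : Type*) [Group Γ] [Countable Γ] (_ : IsSofic Γ)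
      (A : Type*) [MetricSpace A] [CompactSpace A] [MeasurableSpace A] [BorelSpace A]
      (B : Type*) [MetricSpace B] [CompactSpace B] [MeasurableSpace B] [BorelSpace B]
      (κ : Measure A) [IsProbabilityMeasure κ] (l : Measure B) [IsProbabilityMeasure l],
      shannonEntropy κ ≠ shannonEntropy l →
      ¬ MeasureConjugate (shift Γ A) (bernoulliMeasure Γ κ : Measure (Γ → A))
        (shift Γ B) (bernoulliMeasure Γ l : Measure (Γ → B))) ∧
    -- The shifts `(ℤ/2)^F₂` and `(ℤ/2 × ℤ/2)^F₂` with normalized Haar measure are not conjugate.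
    ¬ MeasureConjugate
      (shift (FreeGroup (Fin 2)) (ZMod 2))
      (Measure.addHaarMeasure (⊤ : TopologicalSpace.PositiveCompacts
        (FreeGroup (Fin 2) → ZMod 2)))
      (shift (FreeGroup (Fin 2)) (ZMod 2 × ZMod 2))
      (Measure.addHaarMeasure (⊤ : TopologicalSpace.PositiveCompacts
        (FreeGroup (Fin 2) → ZMod 2 × ZMod 2))) := by
  refine ⟨fun Γ _ _ S hV A _ _ _ _ κ _ d hd ↦ measureSoficEntropy_bernoulli S hV κ d hd,
    fun Γ _ _ hΓ A _ _ _ _ B _ _ _ _ κ _ l _ hne ↦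
      not_measureConjugate_of_shannonEntropy_ne hΓ κ l hne, not_measureConjugate_freeGroup⟩
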